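/- **Conventions.** For a one-parameter subgroup $t\mapsto M^t$ of $\mathrm{GL}(n,\mathbb R)$ (a continuous homomorphism $\mathbb R\to\mathrm{GL}(n,\mathbb R)$), write $M=M^1$ and let $G_M=\mathbb R^n\rtimes_M\mathbb R$ be the Lie group $\mathbb R^n\times\mathbb R$ with multiplication $(x,t)\cdot(y,s)=(x+M^ty,\,t+s)$, with the left-invariant Riemannian metric that is the standard Euclidean one at the identity (at $(x,t)$ it is given by the block matrix $Q_M(t)\oplus 1$ with $Q_M(t)=(M^{-t})^TM^{-t}$) and the corresponding distance. Its horizontal leaves are $P_t=\mathbb R^n\times\{t\}$, $t\in\mathbb R$; those of $G_N$ are denoted $P'_t$. For $K\ge1$, $C\ge0$, a $(K,C)$ quasi-isometry $f:X\to Y$ is a map with $\frac1K d(x,x')-C\le d(f(x),f(x'))\le K\,d(x,x')+C$ for all $x,x'\in X$ and $d(y,f(X))\le C$ for all $y\in Y$. For a quasi-isometry $\phi:G_M\to G_N$, a function $h:\mathbb R\to\mathbb R$ is an *induced time change* with *Hausdorff constant* $A\ge 0$ if the Hausdorff distance between $\phi(P_t)$ and $P'_{h(t)}$ is at most $A$ for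 every $t\in\mathbb R$. We say that $\phi$ coarsely respects the horizontal foliations and their transverse orientations if it has an induced time change $h$ (with some Hausdorff constant) that is coarsely increasing, i.e. there is $L>0$ such that $t>s+L$ implies $h(t)>h(s)$. The *absolute Jordan form* of a real square matrix is obtained from its Jordan form over $\mathbb C$ by replacing each diagonal entry by its absolute value and ordering the blocks by non-increasing diagonal entry, and by non-increasing size among blocks with equal diagonal entry. **Proposition (Time rigidity).** Let $M^t$ and $N^t$ be one-parameter subgroups of $\mathrm{GL}(n,\mathbb R)$ such that $M=M^1$ and $N=N^1$ each have a (complex) eigenvalue of absolute value greater than $1$. Then there exists a real number $m>0$ with the following properties. For all $K\ge1$, $C\ge0$, $A\ge0$ there exists $A'\ge0$ such that, if $\phi:G_M\to G_N$ is a $(K,C)$ quasi-isometry which coarsely respects the horizontal foliations and their transverse orientations and which has an induced time change with Hausdorff constant $A$, then there exists $b\in\mathbb R$ such that $h(t)=mt+b$ is an induced time change for $\phi$ with Hausdorff constant $A'$. Moreover, the absolute Jordan forms of $M$ and of $N$ have least eigenvalues $\alpha$ and $\beta$, respectively, among their eigenvalues greater than $1$, and $m=\log\alpha/\log\beta$.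 -/

import Mathlib

/-! ### Jordan forms -/

/-- The Jordan block `J(k, a)`: `a` on the diagonal, `1` on the superdiagonal, `0` elsewhere. -/
def jordanBlock {R : Type*} [Zero R] [One R] (k : ℕ) (a : R) : Matrix (Fin k) (Fin k) R :=
  Matrix.of fun i j => if i = j then a else if (i : ℕ) + 1 = (j : ℕ) then 1 else 0

/-- The block diagonal matrix with Jordan blocks `J(k 0, a 0), …, J(k (r-1), a (r-1))`, in this
order, as a matrix indexed by `Fin n` where `n = k 0 + ⋯ + k (r-1)`. -/
def jordanMatrix {R : Type*} [Zero R] [One R] {n r : ℕ} (k : Fin r → ℕ) (hk : ∑ i, k i = n)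
    (a : Fin r → R) : Matrix (Fin n) (Fin n) R :=
  Matrix.reindex (finSigmaFinEquiv.trans (finCongr hk)) (finSigmaFinEquiv.trans (finCongr hk))
    (Matrix.blockDiagonal' fun i => jordanBlock (k i) (a i))

/-- `J` is the absolute Jordan form of the real matrix `M`: over `ℂ`, the matrix `M` is conjugate to
a matrix in Jordan form, with blocks `J(k i, a i)`; `J` has the blocks `J(k i, |a i|)`, listed with
non-increasing diagonal entries and, for equal diagonal entries, with non-increasing sizes. -/
def IsAbsoluteJordanForm {n : ℕ} (M J : Matrix (Fin n) (Fin n) ℝ) : Prop :=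
  ∃ (r : ℕ) (k : Fin r → ℕ) (hk : ∑ i, k i = n) (a : Fin r → ℂ),
    (∀ i, 0 < k i) ∧
    (∃ P : Matrix.GeneralLinearGroup (Fin n) ℂ,
      M.map Complex.ofReal =
        P.val * jordanMatrix k hk a * (P⁻¹ : Matrix.GeneralLinearGroup (Fin n) ℂ).val) ∧
    (∀ i j, i < j → ‖a j‖ < ‖a i‖ ∨ (‖a i‖ = ‖a j‖ ∧ k j ≤ k i)) ∧
    J = jordanMatrix k hk fun i => ‖a i‖

/-- The real eigenvalues greater than `1` of a real matrix. -/
def eigenvaluesGtOne {n : ℕ} (J : Matrix (Fin n) (Fin n) ℝ) : Set ℝ :=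
  {x : ℝ | 1 < x ∧ Module.End.HasEigenvalue (Matrix.toLin' J) x}

/-- The real matrix `M` has a (possibly complex) eigenvalue of absolute value greater than `1`. -/
def HasExpandingEigenvalue {n : ℕ} (M : Matrix (Fin n) (Fin n) ℝ) : Prop :=
  ∃ μ : ℂ, Module.End.HasEigenvalue (Matrix.toLin' (M.map Complex.ofReal)) μ ∧ 1 < ‖μ‖

/-! ### One-parameter subgroups and the solvable Lie group `ℝⁿ ⋊_M ℝ` -/

/-- A one-parameter subgroup of `GL(n, ℝ)`: a continuous homomorphism `ℝ → GL(n, ℝ)`. -/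
abbrev OneParameterSubgroup (n : ℕ) : Type :=
  Multiplicative ℝ →ₜ* Matrix.GeneralLinearGroup (Fin n) ℝ

namespace OneParameterSubgroup

/-- The matrix `M^t` of a one-parameter subgroup; `M` itself is `ρ.pow 1`. -/
def pow {n : ℕ} (ρ : OneParameterSubgroup n) (t : ℝ) : Matrix (Fin n) (Fin n) ℝ :=
  (ρ (Multiplicative.ofAdd t)).val

lemma pow_zero {n : ℕ} (ρ : OneParameterSubgroup n) : ρ.pow 0 = 1 := by simp [pow]

lemma pow_add {n : ℕ} (ρ : OneParameterSubgroup n) (s t : ℝ) :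
    ρ.pow (s + t) = ρ.pow s * ρ.pow t := by simp [pow, ofAdd_add]

lemma continuous_pow {n : ℕ} (ρ : OneParameterSubgroup n) : Continuous ρ.pow :=
  Units.continuous_val.comp (ρ.continuous_toFun.comp continuous_ofAdd)

end OneParameterSubgroup

noncomputable section

open scoped Manifold
open Bundle

lemma preconnectedSpace_of_normedSpace (E : Type*) [NormedAddCommGroup E] [NormedSpace ℝ E] :
    PreconnectedSpace E := ⟨(convex_univ (𝕜 := ℝ) (E := E)).isPreconnected⟩

/-- The vector space `ℝⁿ × ℝ`, the global chart of the Lie groups below. -/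
abbrev ModelSpace (n : ℕ) : Type := EuclideanSpace ℝ (Fin n) × ℝ

/-- The solvable Lie group `G_M = ℝⁿ ⋊_M ℝ` of a one-parameter subgroup `ρ(t) = M^t`. Its underlying
manifold is `ℝⁿ × ℝ`; its multiplication and its Riemannian metric are defined below. -/
def SolvableGroup {n : ℕ} (_ρ : OneParameterSubgroup n) : Type := ModelSpace n

namespace SolvableGroup

variable {n : ℕ} {ρ : OneParameterSubgroup n}

/-- The point `(x, t)` of `G_M`. -/
def mk (x : EuclideanSpace ℝ (Fin n)) (t : ℝ) : SolvableGroup ρ := (x, t)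

/-- The coordinate `x` of `(x, t)`. -/
def space (g : SolvableGroup ρ) : EuclideanSpace ℝ (Fin n) := Prod.fst g

/-- The time function `(x, t) ↦ t`. -/
def time (g : SolvableGroup ρ) : ℝ := Prod.snd g

lemma ext {g h : SolvableGroup ρ} (h₁ : g.space = h.space) (h₂ : g.time = h.time) : g = h :=
  Prod.ext h₁ h₂

/-- The group structure `(x, t) * (y, s) = (x + M^t y, t + s)`. -/
instance : Group (SolvableGroup ρ) where
  mul g h := mk (g.space + Matrix.toEuclideanCLM (𝕜 := ℝ) (ρ.pow g.time) h.space) (g.time + h.time)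
  one := mk 0 0
  inv g := mk (-Matrix.toEuclideanCLM (𝕜 := ℝ) (ρ.pow (-g.time)) g.space) (-g.time)
  mul_assoc g h k := by
    apply ext
    · change (g.space + _) + Matrix.toEuclideanCLM (𝕜 := ℝ) (ρ.pow (g.time + h.time)) k.space =
        g.space + Matrix.toEuclideanCLM (𝕜 := ℝ) (ρ.pow g.time)
          (h.space + Matrix.toEuclideanCLM (𝕜 := ℝ) (ρ.pow h.time) k.space)
      rw [ρ.pow_add, map_mul, map_add, add_assoc]
      rfl
    · exact add_assoc _ _ _
  one_mul g := by
    apply ext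
    · change (0 : EuclideanSpace ℝ (Fin n)) +
        Matrix.toEuclideanCLM (𝕜 := ℝ) (ρ.pow 0) g.space = g.space
      simp [ρ.pow_zero]
    · exact zero_add _
  mul_one g := by
    apply ext
    · change g.space + Matrix.toEuclideanCLM (𝕜 := ℝ) (ρ.pow g.time) 0 = g.space
      simp
    · exact add_zero _
  inv_mul_cancel g := by
    apply ext
    · change -_ + Matrix.toEuclideanCLM (𝕜 := ℝ) (ρ.pow (-g.time)) g.space = 0
      simp
    · exact neg_add_cancel g.time

instance : TopologicalSpace (SolvableGroup ρ) :=
  inferInstanceAs (TopologicalSpace (ModelSpace n))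

instance : T3Space (SolvableGroup ρ) := inferInstanceAs (T3Space (ModelSpace n))

/-- The manifold structure of `G_M` is that of `ℝⁿ × ℝ`, with one global chart. -/
instance : ChartedSpace (ModelSpace n) (SolvableGroup ρ) :=
  inferInstanceAs (ChartedSpace (ModelSpace n) (ModelSpace n))

instance : IsManifold 𝓘(ℝ, ModelSpace n) 1 (SolvableGroup ρ) :=
  inferInstanceAs (IsManifold 𝓘(ℝ, ModelSpace n) 1 (ModelSpace n))

instance : PreconnectedSpace (SolvableGroup ρ) :=
  preconnectedSpace_of_normedSpace (ModelSpace n)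

/-- The linear map `(x, s) ↦ M^{-t} x`. Together with the coordinate `s` it gives the differential
at `(y, t)` of the left translation by `(y, t)⁻¹`, which is `(x, s) ↦ (M^{-t} x, s)`. -/
def frame (ρ : OneParameterSubgroup n) (t : ℝ) : ModelSpace n →L[ℝ] EuclideanSpace ℝ (Fin n) :=
  Matrix.toEuclideanCLM (𝕜 := ℝ) (ρ.pow (-t)) ∘L ContinuousLinearMap.fst ℝ _ ℝ

lemma frame_apply (t : ℝ) (v : ModelSpace n) :
    frame ρ t v = Matrix.toEuclideanCLM (𝕜 := ℝ) (ρ.pow (-t)) v.1 := rfl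

lemma toEuclideanCLM_pow_frame (t : ℝ) (v : ModelSpace n) :
    Matrix.toEuclideanCLM (𝕜 := ℝ) (ρ.pow t) (frame ρ t v) = v.1 := by
  change (Matrix.toEuclideanCLM (𝕜 := ℝ) (ρ.pow t) *
    Matrix.toEuclideanCLM (𝕜 := ℝ) (ρ.pow (-t))) v.1 = v.1
  rw [← map_mul, ← ρ.pow_add]
  simp [ρ.pow_zero]

lemma continuous_frame (ρ : OneParameterSubgroup n) : Continuous (frame ρ) := by
  have h : Continuous fun t => Matrix.toEuclideanCLM (n := Fin n) (𝕜 := ℝ) (ρ.pow (-t)) :=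
    (LinearMap.continuous_of_finiteDimensional
      ((Matrix.toEuclideanCLM (n := Fin n) (𝕜 := ℝ)).toAlgEquiv.toLinearMap)).comp
      (ρ.continuous_pow.comp continuous_neg)
  exact h.clm_comp continuous_const

/-- The inner product `⟨(x, s), (x', s')⟩ = ⟨M^{-t} x, M^{-t} x'⟩ + s s'` on `ℝⁿ × ℝ`, that is, the
symmetric form with block matrix `Q_M(t) ⊕ 1`, where `Q_M(t) = (M^{-t})ᵀ M^{-t}`. -/
def metricForm (ρ : OneParameterSubgroup n) (t : ℝ) :
    ModelSpace n →L[ℝ] ModelSpace n →L[ℝ] ℝ :=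
  (innerSL ℝ (E := EuclideanSpace ℝ (Fin n))).bilinearComp (frame ρ t) (frame ρ t) +
    (ContinuousLinearMap.mul ℝ ℝ).bilinearComp (ContinuousLinearMap.snd ℝ _ ℝ)
      (ContinuousLinearMap.snd ℝ _ ℝ)

lemma metricForm_apply (t : ℝ) (v w : ModelSpace n) :
    metricForm ρ t v w = inner ℝ (Matrix.toEuclideanCLM (𝕜 := ℝ) (ρ.pow (-t)) v.1)
      (Matrix.toEuclideanCLM (𝕜 := ℝ) (ρ.pow (-t)) w.1) + v.2 * w.2 := rfl

/-- The differential `(x, s) ↦ (M^t x, s)` of the left translation by `g`, where `t` is the time of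
`g`, is an isometry from the tangent space at `h` to the tangent space at `g * h`. -/
lemma metricForm_mul_left (g h : SolvableGroup ρ) (v w : ModelSpace n) :
    metricForm ρ (g * h).time
      (Matrix.toEuclideanCLM (𝕜 := ℝ) (ρ.pow g.time) v.1, v.2)
      (Matrix.toEuclideanCLM (𝕜 := ℝ) (ρ.pow g.time) w.1, w.2) = metricForm ρ h.time v w := by
  have hp : ρ.pow (-h.time) = ρ.pow (-(g * h).time) * ρ.pow g.time := by
    rw [← ρ.pow_add]
    congr 1
    change _ = -(g.time + h.time) + g.time
    ring
  rw [metricForm_apply, metricForm_apply, hp, map_mul]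
  rfl

lemma metricForm_self (t : ℝ) (v : ModelSpace n) :
    metricForm ρ t v v = ‖frame ρ t v‖ ^ 2 + v.2 ^ 2 := by
  rw [metricForm_apply, ← frame_apply, real_inner_self_eq_norm_sq, sq v.2]

lemma metricForm_symm (t : ℝ) (v w : ModelSpace n) :
    metricForm ρ t v w = metricForm ρ t w v := by
  rw [metricForm_apply, metricForm_apply, real_inner_comm, mul_comm]

lemma metricForm_pos (t : ℝ) (v : ModelSpace n) (hv : v ≠ 0) : 0 < metricForm ρ t v v := by
  rw [metricForm_self]
  by_contra hle
  have h1 : ‖frame ρ t v‖ = 0 := by nlinarith [sq_nonneg ‖frame ρ t v‖, sq_nonneg v.2]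
  have h2 : v.2 = 0 := by nlinarith [sq_nonneg ‖frame ρ t v‖, sq_nonneg v.2]
  refine hv (Prod.ext ?_ h2)
  rw [← toEuclideanCLM_pow_frame (ρ := ρ) t v, norm_eq_zero.1 h1, map_zero]
  rfl

lemma metricForm_isVonNBounded (t : ℝ) :
    Bornology.IsVonNBounded ℝ {v : ModelSpace n | metricForm ρ t v v < 1} := by
  refine ((NormedSpace.isVonNBounded_ball ℝ (ModelSpace n) 1).image
    ((Matrix.toEuclideanCLM (n := Fin n) (𝕜 := ℝ) (ρ.pow t)).prodMap
      (ContinuousLinearMap.id ℝ ℝ))).subset ?_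
  intro v hv
  have h : ‖frame ρ t v‖ ^ 2 + v.2 ^ 2 < 1 := by rw [← metricForm_self]; exact hv
  refine ⟨(frame ρ t v, v.2), ?_, Prod.ext (toEuclideanCLM_pow_frame t v) rfl⟩
  rw [mem_ball_zero_iff, Prod.norm_def, max_lt_iff]
  constructor
  · nlinarith [norm_nonneg (frame ρ t v), sq_nonneg v.2]
  · rw [Real.norm_eq_abs, ← sq_lt_one_iff_abs_lt_one]
    nlinarith [sq_nonneg ‖frame ρ t v‖]

lemma continuous_metricForm (ρ : OneParameterSubgroup n) : Continuous (metricForm ρ) := by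
  have h := continuous_frame ρ
  refine continuous_clm_apply.2 fun v => continuous_clm_apply.2 fun w => ?_
  exact ((h.clm_apply continuous_const).inner (h.clm_apply continuous_const)).add continuous_const

lemma continuous_time : Continuous (time : SolvableGroup ρ → ℝ) :=
  (continuous_snd : Continuous (Prod.snd : ModelSpace n → ℝ))

/-- The left-invariant Riemannian metric on `G_M` that is the standard Euclidean inner product at
the identity. -/
def riemannianMetric (ρ : OneParameterSubgroup n) :
    ContinuousRiemannianMetric (ModelSpace n)
      (fun g : SolvableGroup ρ => TangentSpace 𝓘(ℝ, ModelSpace n) g) where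
  inner g := metricForm ρ g.time
  symm g := metricForm_symm g.time
  pos g := metricForm_pos g.time
  isVonNBounded g := metricForm_isVonNBounded g.time
  continuous := by
    rw [continuous_iff_continuousAt]
    intro g
    rw [continuousAt_hom_bundle]
    refine ⟨continuousAt_id, ?_⟩
    convert! ((continuous_metricForm ρ).comp continuous_time).continuousAt
    rename_i y
    apply ContinuousLinearMap.ext
    intro v
    apply ContinuousLinearMap.ext
    intro w
    have hs : ∀ u,
        (trivializationAt (ModelSpace n) (TangentSpace 𝓘(ℝ, ModelSpace n)) g).symm y u =
          u := fun u => by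
      rw [← Trivialization.symmL_apply (R := ℝ)]
      · exact DFunLike.congr_fun
          (TangentBundle.symmL_model_space (𝕜 := ℝ) (F := ModelSpace n) g y) u
      · exact Set.mem_univ _
    rw [inCoordinates_apply_eq₂ (Set.mem_univ _) (Set.mem_univ _) (Set.mem_univ _)]
    simp only [Trivial.fiberBundle_trivializationAt', Trivial.linearMapAt_trivialization,
        LinearMap.id_coe, id_eq]
    rw [hs, hs]
    rfl

instance : RiemannianBundle
    (fun g : SolvableGroup ρ => TangentSpace 𝓘(ℝ, ModelSpace n) g) :=
  ⟨(riemannianMetric ρ).toRiemannianMetric⟩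

/-- The distance on `G_M` is the Riemannian one, the infimum of the lengths of `C¹` paths. -/
instance : EMetricSpace (SolvableGroup ρ) :=
  EMetricSpace.ofRiemannianMetric 𝓘(ℝ, ModelSpace n) (SolvableGroup ρ)

instance : IsRiemannianManifold 𝓘(ℝ, ModelSpace n) (SolvableGroup ρ) := ⟨fun _ _ => rfl⟩

lemma edist_ne_top (g h : SolvableGroup ρ) : edist g h ≠ ⊤ := by
  have hc : IsClopen (Metric.eball g ⊤) := ⟨Metric.isClosed_eball_top, Metric.isOpen_eball⟩
  have hh : h ∈ Metric.eball g ⊤ := by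
    rw [hc.eq_univ ⟨g, Metric.mem_eball_self ENNReal.zero_lt_top⟩]
    trivial
  rw [edist_comm]
  exact ne_of_lt hh

instance : MetricSpace (SolvableGroup ρ) := EMetricSpace.toMetricSpace edist_ne_top

/-- The norm of a tangent vector `v = (x, s)` at `(y, t)` is `(‖M^{-t} x‖² + s²)^{1/2}`. -/
lemma norm_tangent (g : SolvableGroup ρ) (v : TangentSpace 𝓘(ℝ, ModelSpace n) g) :
    ‖v‖ = √(‖frame ρ g.time v‖ ^ 2 + (Prod.snd (α := EuclideanSpace ℝ (Fin n)) v : ℝ) ^ 2) :=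
  congrArg Real.sqrt (metricForm_self (ρ := ρ) g.time v)

/-- The horizontal leaf `P_t = ℝⁿ × {t}` of `G_M`. -/
def horizontalLeaf (ρ : OneParameterSubgroup n) (t : ℝ) : Set (SolvableGroup ρ) :=
  {g | g.time = t}

end SolvableGroup

end

/-! ### Quasi-isometries respecting the horizontal foliations -/

/-- `f` is a `(K, C)` quasi-isometry. -/
def IsQuasiIsometry {X Y : Type*} [MetricSpace X] [MetricSpace Y] (K C : ℝ) (f : X → Y) : Prop :=
  (∀ x x' : X, 1 / K * dist x x' - C ≤ dist (f x) (f x') ∧ dist (f x) (f x') ≤ K * dist x x' + C) ∧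
  ∀ y : Y, Metric.infDist y (Set.range f) ≤ C

/-- `h` is an induced time change for `φ`, with Hausdorff constant `A`: for every `t`, the Hausdorff
distance (in `[0, ∞]`) between `φ(P_t)` and the horizontal leaf of height `h t` is at most `A`. -/
def IsInducedTimeChange {n : ℕ} {ρ σ : OneParameterSubgroup n}
    (φ : SolvableGroup ρ → SolvableGroup σ) (h : ℝ → ℝ) (A : ℝ) : Prop :=
  0 ≤ A ∧ ∀ t : ℝ, Metric.hausdorffEDist (φ '' SolvableGroup.horizontalLeaf ρ t)
    (SolvableGroup.horizontalLeaf σ (h t)) ≤ ENNReal.ofReal A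

/-- `h : ℝ → ℝ` is coarsely increasing. -/
def IsCoarselyIncreasing (h : ℝ → ℝ) : Prop :=
  ∃ L : ℝ, 0 < L ∧ ∀ s t : ℝ, s + L < t → h s < h t

/-- `φ` coarsely respects the horizontal foliations together with their transverse orientations:
it has an induced time change (with some Hausdorff constant) that is coarsely increasing. -/
def RespectsOrientedHorizontalFoliations {n : ℕ} {ρ σ : OneParameterSubgroup n}
    (φ : SolvableGroup ρ → SolvableGroup σ) : Prop :=
  ∃ (h : ℝ → ℝ) (A : ℝ), IsInducedTimeChange φ h A ∧ IsCoarselyIncreasing h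

/-!
The slope of the time change is found by following pairs of vertical lines into the past, where the
expanding directions of `M` spread them apart. Write `α` for the least modulus greater than `1` of
the complex eigenvalues of `M`, and `β` for that of `N`.

Horizontal leaves are geodesic and uniformly properly embedded
(`SolvableGroup.exists_norm_flow_space_sub_le`), so that a quasi-isometry which coarsely takes
`P_t` to `P'_{h(t)}` distorts the Euclidean distances of these leaves by bounded factors. Take two
vertical lines of `G_M` whose difference is a large vector `v` that grows exactly like `α ^ t`
under `M ^ t`. Their images, moved to the leaves `P'_{h(t)}`, form two pseudo-orbits whose
difference `w` satisfies `w (j + 1) = N ^ (b (j + 1) - b j) (w j) + O(1)` for the times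
`b j = -h (s - j)`. The centre and stable parts of `w` grow subexponentially, while `w` itself grows
exponentially; its unstable part is shadowed by a true orbit `N ^ t u`
(`OneParameterSubgroup.exists_shadow`,
`OneParameterSubgroup.IsLeastExpansion.exists_comparable_orbit`). Hence `‖N ^ (b j - b 0) u‖` is
comparable to `α ^ j`, with constants that depend only on the data.

The vector `u` is contracted in the past, so that `‖N ^ t u‖ ≥ c β ^ t`, with `c` depending on
`u`. Hence `(b j - b 0) log β ≤ j log α + O(1)`, with an error depending on `φ`. The same argument
with the roles of `G_M` and `G_N` exchanged gives the opposite inequality, so that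
`‖N ^ t u‖ = O(β ^ t)`: the vector `u` involves neither larger eigenvalues nor proper Jordan
chains. On the space of such vectors, `N ^ t` is `β ^ t` times a uniformly bi-Lipschitz map
(`OneParameterSubgroup.IsLeastExpansion.exists_bounds`), and comparing once more shows that
`|(b j - b 0) log β - j log α|` is bounded uniformly.

To avoid constructing a coarse inverse, the argument is carried out for relations between `G_M` and
`G_N`, which may be flipped.
-/

/-! ### The linear flow and the distance of `G_M` -/

section

open scoped Manifold ENNReal Bundle
open Set

namespace OneParameterSubgroup

variable {n : ℕ}

/-- The linear flow `t ↦ M^t` on Euclidean space. -/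
noncomputable def flow (ρ : OneParameterSubgroup n) (t : ℝ) :
    EuclideanSpace ℝ (Fin n) →L[ℝ] EuclideanSpace ℝ (Fin n) :=
  Matrix.toEuclideanCLM (𝕜 := ℝ) (ρ.pow t)

lemma flow_zero (ρ : OneParameterSubgroup n) : ρ.flow 0 = 1 := by
  simp [flow, ρ.pow_zero]

lemma flow_add (ρ : OneParameterSubgroup n) (s t : ℝ) : ρ.flow (s + t) = ρ.flow s * ρ.flow t := by
  simp [flow, ρ.pow_add]

lemma flow_zero_apply (ρ : OneParameterSubgroup n) (x : EuclideanSpace ℝ (Fin n)) :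
    ρ.flow 0 x = x := by
  rw [flow_zero]; rfl

lemma flow_flow (ρ : OneParameterSubgroup n) (s t : ℝ) (x : EuclideanSpace ℝ (Fin n)) :
    ρ.flow s (ρ.flow t x) = ρ.flow (s + t) x := by
  rw [flow_add]; rfl

lemma continuous_flow (ρ : OneParameterSubgroup n) : Continuous ρ.flow :=
  (LinearMap.continuous_of_finiteDimensional
    ((Matrix.toEuclideanCLM (n := Fin n) (𝕜 := ℝ)).toAlgEquiv.toLinearMap)).comp ρ.continuous_pow

/-- The operators of the flow are uniformly bounded over bounded time intervals. -/
lemma exists_norm_flow_le (ρ : OneParameterSubgroup n) (D : ℝ) :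
    ∃ C : ℝ, 1 ≤ C ∧ ∀ t : ℝ, |t| ≤ D → ∀ x, ‖ρ.flow t x‖ ≤ C * ‖x‖ := by
  obtain ⟨C, hC⟩ := (isCompact_Icc (a := -D) (b := D)).exists_bound_of_continuousOn
    ρ.continuous_flow.continuousOn
  refine ⟨max C 1, le_max_right _ _, fun t ht x => ?_⟩
  exact (ρ.flow t).le_of_opNorm_le ((hC t (abs_le.1 ht)).trans (le_max_left _ _)) x

end OneParameterSubgroup

namespace SolvableGroup

variable {n : ℕ} {ρ : OneParameterSubgroup n}

lemma pathELength_eq_lintegral (γ : ℝ → SolvableGroup ρ) {a b : ℝ} :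
    Manifold.pathELength 𝓘(ℝ, ModelSpace n) γ a b = ∫⁻ τ in Icc a b, ENNReal.ofReal
      √(‖ρ.flow (-(γ τ).time)
          (derivWithin (F := ModelSpace n) γ (Icc a b) τ).1‖ ^ 2 +
        (derivWithin (F := ModelSpace n) γ (Icc a b) τ).2 ^ 2) := by
  rw [Manifold.pathELength_eq_lintegral_mfderivWithin_Icc]
  refine MeasureTheory.lintegral_congr fun τ => ?_
  rw [← ofReal_norm, norm_tangent]
  have : (mfderivWithin 𝓘(ℝ, ℝ) 𝓘(ℝ, ModelSpace n) γ (Icc a b) τ) =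
      fderivWithin ℝ (F := ModelSpace n) γ (Icc a b) τ := mfderivWithin_eq_fderivWithin
  rw [this]
  rfl

/-- Points at distance less than `D` are joined by a `C¹` path of length less than `D`, which stays
in the ball of radius `D`. -/
lemma exists_path_of_dist_lt {g h : SolvableGroup ρ} {D : ℝ} (hD : dist g h < D) :
    ∃ γ : ℝ → SolvableGroup ρ, γ 0 = g ∧ γ 1 = h ∧
      ContDiffOn ℝ 1 (F := ModelSpace n) γ (Icc 0 1) ∧
      (∀ τ ∈ Icc (0 : ℝ) 1, dist g (γ τ) ≤ D) ∧
      ∫⁻ τ in Icc (0 : ℝ) 1, ENNReal.ofReal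
        √(‖ρ.flow (-(γ τ).time)
            (derivWithin (F := ModelSpace n) γ (Icc 0 1) τ).1‖ ^ 2 +
          (derivWithin (F := ModelSpace n) γ (Icc 0 1) τ).2 ^ 2) ≤ ENNReal.ofReal D := by
  have h0 : 0 < D := dist_nonneg.trans_lt hD
  have h1 : Manifold.riemannianEDist 𝓘(ℝ, ModelSpace n) g h < ENNReal.ofReal D := by
    rw [← IsRiemannianManifold.out (I := 𝓘(ℝ, ModelSpace n)) g h, edist_dist]
    exact (ENNReal.ofReal_lt_ofReal_iff h0).2 hD
  obtain ⟨γ, hγ0, hγ1, hγ, hlen⟩ := Manifold.exists_lt_of_riemannianEDist_lt h1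
  refine ⟨γ, hγ0, hγ1, contMDiffOn_iff_contDiffOn.1 hγ, fun τ hτ => ?_, ?_⟩
  · have h2 := Manifold.riemannianEDist_le_pathELength (hγ.mono (Icc_subset_Icc_right hτ.2)) hγ0 rfl
      hτ.1
    rw [← IsRiemannianManifold.out (I := 𝓘(ℝ, ModelSpace n)) g (γ τ), edist_dist] at h2
    have h3 := (h2.trans (Manifold.pathELength_mono le_rfl hτ.2)).trans hlen.le
    exact (ENNReal.ofReal_le_ofReal_iff h0.le).1 h3
  · rw [← pathELength_eq_lintegral]
    exact hlen.le

/-- A path of speed at most `c` over a unit time interval joins points at distance at most `c`. -/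
lemma dist_le_of_speed_le {γ : ℝ → SolvableGroup ρ} {c : ℝ} (hc : 0 ≤ c)
    (hγ : ContDiffOn ℝ 1 (F := ModelSpace n) γ (Icc 0 1))
    (h : ∀ τ ∈ Icc (0 : ℝ) 1, √(‖ρ.flow (-(γ τ).time)
            (derivWithin (F := ModelSpace n) γ (Icc 0 1) τ).1‖ ^ 2 +
          (derivWithin (F := ModelSpace n) γ (Icc 0 1) τ).2 ^ 2) ≤ c) :
    dist (γ 0) (γ 1) ≤ c := by
  have hγ' : ContMDiffOn 𝓘(ℝ, ℝ) 𝓘(ℝ, ModelSpace n) 1 γ (Icc 0 1) :=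
    contMDiffOn_iff_contDiffOn.2 hγ
  have h1 := Manifold.riemannianEDist_le_pathELength hγ' rfl rfl zero_le_one
  rw [← IsRiemannianManifold.out (I := 𝓘(ℝ, ModelSpace n)) (γ 0) (γ 1), edist_dist,
    pathELength_eq_lintegral] at h1
  refine (ENNReal.ofReal_le_ofReal_iff hc).1 (h1.trans ?_)
  calc _ ≤ ∫⁻ τ in Icc (0 : ℝ) 1, ENNReal.ofReal c :=
        MeasureTheory.setLIntegral_mono' measurableSet_Icc fun τ hτ =>
          ENNReal.ofReal_le_ofReal (h τ hτ)
    _ = ENNReal.ofReal c := by simp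

/-- The time function is `1`-Lipschitz. -/
lemma abs_time_sub_le_dist (g h : SolvableGroup ρ) : |g.time - h.time| ≤ dist g h := by
  refine le_of_forall_gt_imp_ge_of_dense fun D hD => ?_
  obtain ⟨γ, hγ0, hγ1, hγ, -, hlen⟩ := exists_path_of_dist_lt hD
  have hs : ContDiffOn ℝ 1 (fun τ => (γ τ).time) (Icc 0 1) := hγ.snd
  have h1 := enorm_sub_le_lintegral_derivWithin_Icc_of_contDiffOn_Icc hs zero_le_one
  simp only [hγ0, hγ1] at h1
  have h2 : ENNReal.ofReal |g.time - h.time| ≤ ENNReal.ofReal D := by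
    rw [abs_sub_comm, ← Real.norm_eq_abs, ofReal_norm]
    refine (h1.trans (MeasureTheory.setLIntegral_mono' measurableSet_Icc fun τ hτ => ?_)).trans hlen
    rw [← ofReal_norm]
    refine ENNReal.ofReal_le_ofReal ?_
    have hd : derivWithin (fun τ => (γ τ).time) (Icc 0 1) τ =
        (derivWithin (F := ModelSpace n) γ (Icc 0 1) τ).2 :=
      ((ContinuousLinearMap.snd ℝ (EuclideanSpace ℝ (Fin n)) ℝ).hasFDerivAt.comp_hasDerivWithinAt τ
        (hγ.differentiableOn (by norm_num) τ hτ).hasDerivWithinAt).derivWithin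
        (uniqueDiffOn_Icc_zero_one τ hτ)
    rw [hd, Real.norm_eq_abs]
    exact Real.abs_le_sqrt (le_add_of_nonneg_left (sq_nonneg _))
  exact (ENNReal.ofReal_le_ofReal_iff (dist_nonneg.trans hD.le)).1 h2

/-- Horizontal leaves are uniformly properly embedded: points at distance at most `D` have
horizontal displacement bounded in terms of `D`. -/
lemma exists_norm_flow_space_sub_le (ρ : OneParameterSubgroup n) (D : ℝ) :
    ∃ Ψ : ℝ, 0 ≤ Ψ ∧ ∀ g h : SolvableGroup ρ, dist g h ≤ D →
      ‖ρ.flow (-g.time) (g.space - h.space)‖ ≤ Ψ := by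
  obtain ⟨C, hC1, hC⟩ := ρ.exists_norm_flow_le (D + 1)
  have hC0 : 0 ≤ C := by linarith
  refine ⟨C * (|D| + 1), by positivity, fun g h hgh => ?_⟩
  have hD0 : 0 ≤ D := dist_nonneg.trans hgh
  rw [abs_of_nonneg hD0]
  obtain ⟨γ, hγ0, hγ1, hγ, hball, hlen⟩ := exists_path_of_dist_lt
    (hgh.trans_lt (lt_add_one D))
  have hs : ContDiffOn ℝ 1 (fun τ => ρ.flow (-g.time) (γ τ).space) (Icc 0 1) :=
    (ρ.flow (-g.time)).contDiff.comp_contDiffOn (hγ.fst)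
  have h1 := enorm_sub_le_lintegral_derivWithin_Icc_of_contDiffOn_Icc hs zero_le_one
  simp only [hγ0, hγ1] at h1
  rw [← neg_sub h.space, map_neg, norm_neg, map_sub]
  have h2 : ENNReal.ofReal ‖ρ.flow (-g.time) h.space - ρ.flow (-g.time) g.space‖ ≤
      ENNReal.ofReal (C * (D + 1)) := by
    rw [ofReal_norm, ENNReal.ofReal_mul hC0]
    refine h1.trans (le_trans ?_ (mul_le_mul_right hlen _))
    rw [← MeasureTheory.lintegral_const_mul' _ _ ENNReal.ofReal_ne_top]
    refine MeasureTheory.setLIntegral_mono' measurableSet_Icc fun τ hτ => ?_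
    rw [← ofReal_norm, ← ENNReal.ofReal_mul hC0]
    refine ENNReal.ofReal_le_ofReal ?_
    have hd : derivWithin (fun τ => ρ.flow (-g.time) (γ τ).space) (Icc 0 1) τ =
        ρ.flow (-g.time) (derivWithin (F := ModelSpace n) γ (Icc 0 1) τ).1 :=
      ((ρ.flow (-g.time)).hasFDerivAt.comp_hasDerivWithinAt τ
        (hγ.differentiableOn (by norm_num) τ hτ).hasDerivWithinAt.fst).derivWithin
        (uniqueDiffOn_Icc_zero_one τ hτ)
    rw [hd]
    set v := (derivWithin (F := ModelSpace n) γ (Icc 0 1) τ)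
    have h3 : ρ.flow (-g.time) v.1 = ρ.flow ((γ τ).time - g.time) (ρ.flow (-(γ τ).time) v.1) := by
      rw [OneParameterSubgroup.flow_flow]
      congr 2
      ring
    rw [h3]
    refine (hC _ ?_ _).trans (mul_le_mul_of_nonneg_left ?_ hC0)
    · rw [abs_sub_comm]
      exact (abs_time_sub_le_dist _ _).trans (hball τ hτ)
    · exact Real.le_sqrt_of_sq_le (by nlinarith [sq_nonneg v.2])
  exact (ENNReal.ofReal_le_ofReal_iff (by positivity)).1 h2

lemma dist_mk_mk_time_le (x : EuclideanSpace ℝ (Fin n)) (t s : ℝ) :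
    dist (mk x t : SolvableGroup ρ) (mk x s) ≤ |t - s| := by
  let γ : ℝ → ModelSpace n := fun τ => (x, t + τ * (s - t))
  have hd : ∀ τ, HasDerivAt γ (0, s - t) τ := fun τ =>
    (hasDerivAt_const τ x).prodMk (by simpa using ((hasDerivAt_id τ).mul_const (s - t)).const_add t)
  have hγ : ContDiff ℝ 1 γ := contDiff_const.prodMk (by fun_prop)
  have h := dist_le_of_speed_le (ρ := ρ) (γ := γ) (abs_nonneg (t - s)) hγ.contDiffOn fun τ hτ => by
    rw [(hd τ).hasDerivWithinAt.derivWithin (uniqueDiffOn_Icc_zero_one τ hτ)]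
    simp [Real.sqrt_sq_eq_abs, abs_sub_comm]
  simpa [γ, mk] using h

lemma dist_mk_mk_space_le (x y : EuclideanSpace ℝ (Fin n)) (t : ℝ) :
    dist (mk x t : SolvableGroup ρ) (mk y t) ≤ ‖ρ.flow (-t) (x - y)‖ := by
  let γ : ℝ → ModelSpace n := fun τ => (x + τ • (y - x), t)
  have hd : ∀ τ, HasDerivAt γ (y - x, 0) τ := fun τ =>
    (by simpa using ((hasDerivAt_id τ).smul_const (y - x)).const_add x :
      HasDerivAt (fun τ : ℝ => x + τ • (y - x)) (y - x) τ).prodMk (hasDerivAt_const τ t)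
  have hγ : ContDiff ℝ 1 γ := ContDiff.prodMk (by fun_prop) contDiff_const
  have h := dist_le_of_speed_le (ρ := ρ) (γ := γ) (norm_nonneg (ρ.flow (-t) (x - y)))
    hγ.contDiffOn fun τ hτ => by
    rw [(hd τ).hasDerivWithinAt.derivWithin (uniqueDiffOn_Icc_zero_one τ hτ)]
    have : time (ρ := ρ) (γ τ) = t := rfl
    rw [this, ← neg_sub x y, map_neg, norm_neg]
    simp only [ne_eq, OfNat.ofNat_ne_zero, not_false_eq_true, zero_pow, add_zero, norm_nonneg,
      Real.sqrt_sq, le_refl]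
  simpa [γ, mk] using h

end SolvableGroup

end

section

open scoped Topology
open Set Filter

/-! ### Growth of vectors under iteration -/

section Complex

variable {V : Type*} [NormedAddCommGroup V] [NormedSpace ℂ V]

/-- The vectors whose iterates under `S` grow at most like `r ^ k`. -/
def powGrowth (S : Module.End ℂ V) (r : ℝ) : Submodule ℂ V where
  carrier := {z | ∃ C : ℝ, ∀ k : ℕ, ‖(S ^ k) z‖ ≤ C * r ^ k}
  add_mem' := by
    rintro x y ⟨C, hC⟩ ⟨D, hD⟩
    refine ⟨C + D, fun k => ?_⟩
    rw [map_add, add_mul]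
    exact (norm_add_le _ _).trans (add_le_add (hC k) (hD k))
  zero_mem' := ⟨0, fun k => by simp⟩
  smul_mem' := by
    rintro c x ⟨C, hC⟩
    refine ⟨‖c‖ * C, fun k => ?_⟩
    rw [map_smul, norm_smul, mul_assoc]
    exact mul_le_mul_of_nonneg_left (hC k) (norm_nonneg c)

lemma powGrowth_apply_mem {S : Module.End ℂ V} {r : ℝ} {z : V} (hz : z ∈ powGrowth S r) :
    S z ∈ powGrowth S r := by
  obtain ⟨C, hC⟩ := hz
  refine ⟨C * r, fun k => ?_⟩
  have := hC (k + 1)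
  rwa [pow_succ, Module.End.mul_apply, pow_succ', ← mul_assoc] at this

/-- Solutions of `S z = ν z + y` grow no faster than `r ^ k` if `y` does not and `‖ν‖ < r`. -/
lemma mem_powGrowth_of_apply_eq {S : Module.End ℂ V} {r : ℝ} {ν : ℂ} (hν : ‖ν‖ < r) {z y : V}
    (hz : S z = ν • z + y) (hy : y ∈ powGrowth S r) : z ∈ powGrowth S r := by
  obtain ⟨C, hC⟩ := hy
  have hr : 0 < r := (norm_nonneg ν).trans_lt hν
  have hr' : 0 < r - ‖ν‖ := sub_pos.2 hν
  -- The constant is the fixed point of the recursion `a ↦ (‖ν‖ a + C) / r`, or the initial value.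
  set D := max ‖z‖ (C / (r - ‖ν‖)) with hD
  have hCD : C ≤ D * (r - ‖ν‖) := (div_le_iff₀ hr').1 (le_max_right _ _)
  refine ⟨D, fun k => ?_⟩
  induction k with
  | zero => rw [pow_zero, Module.End.one_apply, pow_zero, mul_one]; exact le_max_left _ _
  | succ k ih =>
    rw [pow_succ, Module.End.mul_apply, hz, map_add, map_smul]
    calc ‖ν • (S ^ k) z + (S ^ k) y‖ ≤ ‖ν‖ * (D * r ^ k) + C * r ^ k := by
          refine (norm_add_le _ _).trans (add_le_add ?_ (hC k))
          rw [norm_smul]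
          exact mul_le_mul_of_nonneg_left ih (norm_nonneg _)
      _ ≤ ‖ν‖ * (D * r ^ k) + D * (r - ‖ν‖) * r ^ k := by gcongr
      _ = D * r ^ (k + 1) := by ring

lemma maxGenEigenspace_le_powGrowth (T : Module.End ℂ V) {μ : ℂ} {r : ℝ} (h : ‖μ‖ < r) :
    T.maxGenEigenspace μ ≤ powGrowth T r := by
  intro z hz
  obtain ⟨N, hN⟩ := (Module.End.mem_maxGenEigenspace T μ z).1 hz
  clear hz
  induction N generalizing z with
  | zero => rw [pow_zero, Module.End.one_apply] at hN; rw [hN]; exact zero_mem _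
  | succ N ih =>
    refine mem_powGrowth_of_apply_eq h (y := (T - μ • 1) z) ?_ (ih ?_)
    · simp
    · rwa [pow_succ, Module.End.mul_apply] at hN

lemma maxGenEigenspace_le_powGrowth_inv {T S : Module.End ℂ V} (hST : S * T = 1) {μ : ℂ} {r : ℝ}
    (hr : 0 < r) (h : r < ‖μ‖) : T.maxGenEigenspace μ ≤ powGrowth S r⁻¹ := by
  intro z hz
  obtain ⟨N, hN⟩ := (Module.End.mem_maxGenEigenspace T μ z).1 hz
  have hμ : μ ≠ 0 := norm_pos_iff.1 (hr.trans h)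
  clear hz
  induction N generalizing z with
  | zero => rw [pow_zero, Module.End.one_apply] at hN; rw [hN]; exact zero_mem _
  | succ N ih =>
    have hy : (T - μ • 1) z ∈ powGrowth S r⁻¹ := ih <| by
      rwa [pow_succ, Module.End.mul_apply] at hN
    refine mem_powGrowth_of_apply_eq (ν := μ⁻¹) (y := -μ⁻¹ • S ((T - μ • 1) z)) ?_ ?_
      (Submodule.smul_mem _ _ (powGrowth_apply_mem hy))
    · rw [norm_inv]; exact inv_strictAnti₀ hr h
    · have h1 : S (T z) = z := by rw [← Module.End.mul_apply, hST, Module.End.one_apply]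
      simp only [LinearMap.sub_apply, LinearMap.smul_apply, Module.End.one_apply, map_sub,
        map_smul, h1, smul_sub, smul_smul]
      simp [hμ]

/-- If the moduli of the eigenvalues of `T` avoid `[r₁, r₂]`, every vector is the sum of one that
grows more slowly than `r₁ ^ k` in the future and one that decays like `r₂ ^ (-k)` in the past. -/
lemma powGrowth_sup_powGrowth_inv_eq_top [FiniteDimensional ℂ V] {T S : Module.End ℂ V}
    (hST : S * T = 1) {r₁ r₂ : ℝ} (hr₂ : 0 < r₂)
    (h : ∀ μ, T.HasEigenvalue μ → ‖μ‖ < r₁ ∨ r₂ < ‖μ‖) :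
    powGrowth T r₁ ⊔ powGrowth S r₂⁻¹ = ⊤ := by
  rw [eq_top_iff, ← Module.End.iSup_maxGenEigenspace_eq_top T, iSup_le_iff]
  intro μ
  by_cases hμ : T.HasEigenvalue μ
  · rcases h μ hμ with h | h
    · exact (maxGenEigenspace_le_powGrowth T h).trans le_sup_left
    · exact (maxGenEigenspace_le_powGrowth_inv hST hr₂ h).trans le_sup_right
  · have : T.maxGenEigenspace μ = ⊥ := by
      by_contra hne
      exact hμ (Module.End.HasUnifEigenvalue.lt (m := 1) (k := ⊤) one_pos hne)
    rw [this]
    exact bot_le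

/-- The cyclic subspace generated by a nonzero vector contains an eigenvector. -/
lemma exists_aeval_hasEigenvector [FiniteDimensional ℂ V] (T : Module.End ℂ V) {z : V}
    (hz : z ≠ 0) : ∃ (p : Polynomial ℂ) (μ : ℂ), T.HasEigenvector μ (Polynomial.aeval T p z) := by
  let f : Polynomial ℂ →ₗ[ℂ] V := (LinearMap.applyₗ z).comp (Polynomial.aeval T).toLinearMap
  have hf : ∀ p, f p = Polynomial.aeval T p z := fun p => rfl
  have hT : ∀ w ∈ LinearMap.range f, T w ∈ LinearMap.range f := by
    rintro _ ⟨p, rfl⟩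
    exact ⟨Polynomial.X * p, by simp [hf]⟩
  have hz' : z ∈ LinearMap.range f := ⟨1, by simp [hf]⟩
  have : Nontrivial (LinearMap.range f) :=
    ⟨⟨z, hz'⟩, 0, fun h => hz (congrArg Subtype.val h)⟩
  obtain ⟨μ, hμ⟩ := Module.End.exists_eigenvalue (T.restrict hT)
  obtain ⟨⟨_, p, rfl⟩, hv⟩ := hμ.exists_hasEigenvector
  refine ⟨p, μ, Module.End.mem_eigenspace_iff.2 ?_, fun h => hv.2 (Subtype.ext h)⟩
  exact congrArg Subtype.val (Module.End.mem_eigenspace_iff.1 hv.1)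

lemma LinearMap.exists_norm_apply_le {𝕜 E F : Type*} [NontriviallyNormedField 𝕜] [CompleteSpace 𝕜]
    [NormedAddCommGroup E] [NormedSpace 𝕜 E] [FiniteDimensional 𝕜 E] [NormedAddCommGroup F]
    [NormedSpace 𝕜 F] (f : E →ₗ[𝕜] F) : ∃ C : ℝ, 0 < C ∧ ∀ x, ‖f x‖ ≤ C * ‖x‖ :=
  ⟨‖LinearMap.toContinuousLinearMap f‖ + 1, by positivity, fun x =>
    (LinearMap.toContinuousLinearMap f).le_of_opNorm_le (le_add_of_nonneg_right zero_le_one) x⟩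

end Complex

namespace OneParameterSubgroup

variable {n : ℕ}

/-! ### The complexified flow -/

/-- The complexification of `M^t`, acting on `ℂⁿ`. -/
noncomputable def complexFlow (ρ : OneParameterSubgroup n) (t : ℝ) : Module.End ℂ (Fin n → ℂ) :=
  Matrix.toLin' ((ρ.pow t).map Complex.ofReal)

lemma complexFlow_zero (ρ : OneParameterSubgroup n) : ρ.complexFlow 0 = 1 := by
  rw [complexFlow, ρ.pow_zero, Matrix.map_one _ (by simp) (by simp), Matrix.toLin'_one]
  rfl

lemma complexFlow_add (ρ : OneParameterSubgroup n) (s t : ℝ) :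
    ρ.complexFlow (s + t) = ρ.complexFlow s * ρ.complexFlow t := by
  rw [complexFlow, ρ.pow_add]
  have : (ρ.pow s * ρ.pow t).map Complex.ofReal =
      (ρ.pow s).map Complex.ofReal * (ρ.pow t).map Complex.ofReal :=
    Matrix.map_mul (f := Complex.ofRealHom)
  rw [this, Matrix.toLin'_mul]
  rfl

lemma complexFlow_pow (ρ : OneParameterSubgroup n) (t : ℝ) (k : ℕ) :
    ρ.complexFlow t ^ k = ρ.complexFlow (t * k) := by
  induction k with
  | zero => simp [complexFlow_zero]
  | succ k ih => rw [pow_succ, ih, ← complexFlow_add]; congr 1; push_cast; ring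

/-- The real part of a vector of `ℂⁿ`. -/
noncomputable def rePart (n : ℕ) : (Fin n → ℂ) →ₗ[ℝ] EuclideanSpace ℝ (Fin n) where
  toFun z := WithLp.toLp 2 fun i => (z i).re
  map_add' x y := by ext i; simp
  map_smul' c x := by ext i; simp

/-- The imaginary part of a vector of `ℂⁿ`. -/
noncomputable def imPart (n : ℕ) : (Fin n → ℂ) →ₗ[ℝ] EuclideanSpace ℝ (Fin n) where
  toFun z := WithLp.toLp 2 fun i => (z i).im
  map_add' x y := by ext i; simp
  map_smul' c x := by ext i; simp

/-- The inclusion of `ℝⁿ` in `ℂⁿ`. -/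
noncomputable def toComplex (n : ℕ) : EuclideanSpace ℝ (Fin n) →ₗ[ℝ] (Fin n → ℂ) where
  toFun x := fun i => (x i : ℂ)
  map_add' x y := by ext i; simp
  map_smul' c x := by ext i; simp

lemma rePart_toComplex (x : EuclideanSpace ℝ (Fin n)) : rePart n (toComplex n x) = x := by
  ext i; simp [rePart, toComplex]

lemma flow_apply (ρ : OneParameterSubgroup n) (t : ℝ) (x : EuclideanSpace ℝ (Fin n)) (i : Fin n) :
    ρ.flow t x i = ∑ j, ρ.pow t i j * x j := by
  simp [flow, Matrix.mulVec, dotProduct]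

lemma complexFlow_apply (ρ : OneParameterSubgroup n) (t : ℝ) (z : Fin n → ℂ) (i : Fin n) :
    ρ.complexFlow t z i = ∑ j, (ρ.pow t i j : ℂ) * z j := by
  simp [complexFlow, Matrix.mulVec, dotProduct]

lemma rePart_complexFlow (ρ : OneParameterSubgroup n) (t : ℝ) (z : Fin n → ℂ) :
    rePart n (ρ.complexFlow t z) = ρ.flow t (rePart n z) := by
  ext i
  rw [flow_apply]
  simp [rePart, complexFlow_apply]

lemma imPart_complexFlow (ρ : OneParameterSubgroup n) (t : ℝ) (z : Fin n → ℂ) :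
    imPart n (ρ.complexFlow t z) = ρ.flow t (imPart n z) := by
  ext i
  rw [flow_apply]
  simp [imPart, complexFlow_apply]

lemma complexFlow_toComplex (ρ : OneParameterSubgroup n) (t : ℝ) (x : EuclideanSpace ℝ (Fin n)) :
    ρ.complexFlow t (toComplex n x) = toComplex n (ρ.flow t x) := by
  ext i
  rw [complexFlow_apply]
  simp [toComplex, flow_apply]

/-! ### Growth of orbits -/

/-- The vectors `x` with `‖M^(ε t) x‖ = O(r ^ t)` for `t ≥ 0`. For `ε = 1` this bounds the growth of
the future orbit of `x`, for `ε = -1` that of the past orbit. -/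
def growth (ρ : OneParameterSubgroup n) (ε r : ℝ) : Submodule ℝ (EuclideanSpace ℝ (Fin n)) where
  carrier := {x | ∃ C : ℝ, ∀ t : ℝ, 0 ≤ t → ‖ρ.flow (ε * t) x‖ ≤ C * r ^ t}
  add_mem' := by
    rintro x y ⟨C, hC⟩ ⟨D, hD⟩
    refine ⟨C + D, fun t ht => ?_⟩
    rw [map_add, add_mul]
    exact (norm_add_le _ _).trans (add_le_add (hC t ht) (hD t ht))
  zero_mem' := ⟨0, fun t ht => by simp⟩
  smul_mem' := by
    rintro c x ⟨C, hC⟩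
    refine ⟨‖c‖ * C, fun t ht => ?_⟩
    rw [map_smul, norm_smul, mul_assoc]
    exact mul_le_mul_of_nonneg_left (hC t ht) (norm_nonneg c)

/-- Growth can be tested at integer times. -/
lemma mem_growth_of_nat {ρ : OneParameterSubgroup n} {ε r : ℝ} (hr : 0 < r)
    {x : EuclideanSpace ℝ (Fin n)} {C : ℝ}
    (h : ∀ k : ℕ, ‖ρ.flow (ε * k) x‖ ≤ C * r ^ k) : x ∈ ρ.growth ε r := by
  obtain ⟨D, hD1, hD⟩ := ρ.exists_norm_flow_le |ε|
  have hC : 0 ≤ C := by simpa using (norm_nonneg _).trans (h 0)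
  refine ⟨D * C * max 1 r⁻¹, fun t ht => ?_⟩
  set k := ⌊t⌋₊
  have hk1 : (k : ℝ) ≤ t := Nat.floor_le ht
  have hk2 : t - k ≤ 1 := by linarith [Nat.lt_floor_add_one t]
  have h1 : ρ.flow (ε * t) x = ρ.flow (ε * (t - k)) (ρ.flow (ε * k) x) := by
    rw [flow_flow]; congr 2; ring
  have h2 : r ^ k ≤ max 1 r⁻¹ * r ^ t := by
    have : r ^ k = r⁻¹ ^ (t - k) * r ^ t := by
      rw [Real.inv_rpow hr.le, ← Real.rpow_neg hr.le, ← Real.rpow_add hr, ← Real.rpow_natCast]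
      congr 1; ring
    rw [this]
    gcongr
    calc r⁻¹ ^ (t - k) ≤ (max 1 r⁻¹) ^ (t - k) :=
          Real.rpow_le_rpow (inv_nonneg.2 hr.le) (le_max_right _ _) (by linarith)
      _ ≤ (max 1 r⁻¹) ^ (1 : ℝ) := Real.rpow_le_rpow_of_exponent_le (le_max_left _ _) hk2
      _ = _ := Real.rpow_one _
  rw [h1]
  have h3 : |ε * (t - k)| ≤ |ε| := by
    rw [abs_mul]
    exact mul_le_of_le_one_right (abs_nonneg _) (abs_le.2 ⟨by linarith, hk2⟩)
  calc _ ≤ D * (C * r ^ k) := (hD _ h3 _).trans (by gcongr; exact h k)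
    _ ≤ D * (C * (max 1 r⁻¹ * r ^ t)) := by gcongr
    _ = _ := by ring

/-- By the uniform boundedness principle the implied constants on a growth subspace are uniform. -/
lemma exists_norm_flow_le_of_mem_growth (ρ : OneParameterSubgroup n) (ε : ℝ) {r : ℝ} (hr : 0 < r) :
    ∃ C : ℝ, 0 < C ∧ ∀ x ∈ ρ.growth ε r, ∀ t : ℝ, 0 ≤ t →
      ‖ρ.flow (ε * t) x‖ ≤ C * r ^ t * ‖x‖ := by
  let g : {t : ℝ // 0 ≤ t} → (ρ.growth ε r) →L[ℝ] EuclideanSpace ℝ (Fin n) := fun t =>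
    (r ^ t.1)⁻¹ • ((ρ.flow (ε * t.1)).comp (ρ.growth ε r).subtypeL)
  obtain ⟨C, hC⟩ := banach_steinhaus (g := g) fun x => by
    obtain ⟨C, hC⟩ := x.2
    refine ⟨C, fun t => ?_⟩
    have hpos : 0 < r ^ t.1 := Real.rpow_pos_of_pos hr _
    have : g t x = (r ^ t.1)⁻¹ • ρ.flow (ε * t.1) x := rfl
    rw [this, norm_smul, norm_inv, Real.norm_of_nonneg hpos.le, inv_mul_le_iff₀ hpos,
      mul_comm (r ^ t.1)]
    exact hC t.1 t.2
  refine ⟨|C| + 1, by positivity, fun x hx t ht => ?_⟩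
  have hpos : 0 < r ^ t := Real.rpow_pos_of_pos hr _
  have h1 := (g ⟨t, ht⟩).le_of_opNorm_le ((hC ⟨t, ht⟩).trans
    ((le_abs_self C).trans (le_add_of_nonneg_right zero_le_one))) ⟨x, hx⟩
  have : g ⟨t, ht⟩ ⟨x, hx⟩ = (r ^ t)⁻¹ • ρ.flow (ε * t) x := rfl
  rw [this, norm_smul, norm_inv, Real.norm_of_nonneg hpos.le, inv_mul_le_iff₀ hpos] at h1
  exact h1.trans_eq (by rw [Submodule.coe_norm]; ring)

/-- `α` is the least modulus greater than `1` of the complex eigenvalues of `M`. -/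
def IsLeastExpansion (ρ : OneParameterSubgroup n) (α : ℝ) : Prop :=
  IsLeast {r : ℝ | 1 < r ∧ ∃ μ : ℂ, (ρ.complexFlow 1).HasEigenvalue μ ∧ ‖μ‖ = r} α

lemma exists_isLeastExpansion (ρ : OneParameterSubgroup n)
    (h : HasExpandingEigenvalue (ρ.pow 1)) : ∃ α, ρ.IsLeastExpansion α := by
  obtain ⟨μ, hμ, h1⟩ := h
  have hfin : {r : ℝ | 1 < r ∧ ∃ μ : ℂ, (ρ.complexFlow 1).HasEigenvalue μ ∧ ‖μ‖ = r}.Finite := by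
    refine ((Module.End.finite_hasEigenvalue (ρ.complexFlow 1)).image norm).subset ?_
    rintro r ⟨-, μ, hμ, rfl⟩
    exact ⟨μ, hμ, rfl⟩
  obtain ⟨a, ha⟩ := hfin.exists_minimal ⟨‖μ‖, h1, μ, hμ, rfl⟩
  exact ⟨a, ha.1, fun b hb => (le_total a b).elim id fun h => ha.2 hb h⟩

variable {ρ : OneParameterSubgroup n} {α : ℝ}

/-- The dominated splitting of `ℝⁿ` into vectors of slow growth in the future and vectors
contracted in the past, uniformly in the vector. The linear map `P` need not commute with the
flow. -/
lemma IsLeastExpansion.exists_splitting (hα : ρ.IsLeastExpansion α) {r₁ r₂ : ℝ} (h₁ : 1 < r₁)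
    (h₂ : 1 < r₂) (h₂α : r₂ < α) :
    ∃ (P : EuclideanSpace ℝ (Fin n) →ₗ[ℝ] EuclideanSpace ℝ (Fin n)) (C : ℝ), 0 < C ∧
      (∀ x, P x ∈ ρ.growth (-1) r₂⁻¹) ∧
      (∀ x t, 0 ≤ t → ‖ρ.flow t (x - P x)‖ ≤ C * r₁ ^ t * ‖x‖) ∧
      (∀ x t, 0 ≤ t → ‖ρ.flow (-t) (P x)‖ ≤ C * r₂⁻¹ ^ t * ‖x‖) := by
  have hr₁ : 0 < r₁ := by linarith
  have hr₂ : 0 < r₂ := by linarith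
  have hST : ρ.complexFlow (-1) * ρ.complexFlow 1 = 1 := by
    rw [← complexFlow_add, neg_add_cancel, complexFlow_zero]
  have htop := powGrowth_sup_powGrowth_inv_eq_top (r₁ := r₁) hST hr₂ fun μ hμ => by
    rcases le_or_gt ‖μ‖ 1 with h | h
    · exact Or.inl (h.trans_lt h₁)
    · exact Or.inr (h₂α.trans_le (hα.2 ⟨h, μ, hμ, rfl⟩))
  obtain ⟨Cre, hCre0, hCre⟩ := LinearMap.exists_norm_apply_le (rePart n)
  have key : ∀ ε r : ℝ, 0 < r → ∀ z ∈ powGrowth (ρ.complexFlow ε) r,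
      rePart n z ∈ ρ.growth ε r := by
    rintro ε r hr z ⟨C, hC⟩
    refine mem_growth_of_nat (C := Cre * C) hr fun k => ?_
    rw [← rePart_complexFlow, ← complexFlow_pow, mul_assoc]
    exact (hCre _).trans (mul_le_mul_of_nonneg_left (hC k) hCre0.le)
  set F := ρ.growth 1 r₁
  set B := ρ.growth (-1) r₂⁻¹
  have hsurj : Function.Surjective (F.subtype.coprod B.subtype) := by
    intro x
    have hx : toComplex n x ∈ powGrowth (ρ.complexFlow 1) r₁ ⊔
        powGrowth (ρ.complexFlow (-1)) r₂⁻¹ := by rw [htop]; trivial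
    obtain ⟨z₁, hz₁, z₂, hz₂, h⟩ := Submodule.mem_sup.1 hx
    refine ⟨(⟨_, key 1 r₁ hr₁ z₁ hz₁⟩, ⟨_, key (-1) r₂⁻¹ (inv_pos.2 hr₂) z₂ hz₂⟩), ?_⟩
    simp [← map_add, h, rePart_toComplex]
  obtain ⟨g, hg⟩ := LinearMap.exists_rightInverse_of_surjective _ (LinearMap.range_eq_top.2 hsurj)
  let P := B.subtype.comp ((LinearMap.snd ℝ F B).comp g)
  have hP : ∀ x, x - P x = (g x).1 := fun x => by
    have := LinearMap.congr_fun hg x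
    simp only [LinearMap.comp_apply, LinearMap.coprod_apply, LinearMap.id_apply] at this
    rw [sub_eq_iff_eq_add]
    exact this.symm
  obtain ⟨C₁, hC₁0, hC₁⟩ := ρ.exists_norm_flow_le_of_mem_growth 1 hr₁
  obtain ⟨C₂, hC₂0, hC₂⟩ := ρ.exists_norm_flow_le_of_mem_growth (-1) (inv_pos.2 hr₂)
  obtain ⟨D₁, hD₁0, hD₁⟩ := LinearMap.exists_norm_apply_le (LinearMap.id - P)
  obtain ⟨D₂, hD₂0, hD₂⟩ := LinearMap.exists_norm_apply_le P
  refine ⟨P, C₁ * D₁ + C₂ * D₂, by positivity, fun x => (g x).2.2, fun x t ht => ?_,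
    fun x t ht => ?_⟩
  · have h1 := hC₁ (x - P x) (by rw [hP]; exact (g x).1.2) t ht
    rw [one_mul] at h1
    have hpow : 0 < r₁ ^ t := Real.rpow_pos_of_pos hr₁ _
    calc _ ≤ C₁ * r₁ ^ t * (D₁ * ‖x‖) := h1.trans (by gcongr; exact hD₁ x)
      _ ≤ C₁ * r₁ ^ t * (D₁ * ‖x‖) + C₂ * r₁ ^ t * (D₂ * ‖x‖) :=
        le_add_of_nonneg_right (by positivity)
      _ = _ := by ring
  · have h1 := hC₂ (P x) (g x).2.2 t ht
    rw [neg_one_mul] at h1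
    have hpow : 0 < r₂⁻¹ ^ t := Real.rpow_pos_of_pos (inv_pos.2 hr₂) _
    calc _ ≤ C₂ * r₂⁻¹ ^ t * (D₂ * ‖x‖) := h1.trans (by gcongr; exact hD₂ x)
      _ ≤ C₁ * r₂⁻¹ ^ t * (D₁ * ‖x‖) + C₂ * r₂⁻¹ ^ t * (D₂ * ‖x‖) :=
        le_add_of_nonneg_left (by positivity)
      _ = _ := by ring

/-- A nonzero vector contracted exponentially in the past expands at least like `α ^ t`: an
eigenvector in its complex cyclic subspace is also contracted in the past, so that its eigenvalue
has modulus at least `α`. The constant depends on the vector. -/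
lemma IsLeastExpansion.exists_le_norm_flow (hα : ρ.IsLeastExpansion α) {r : ℝ} (hr : 1 < r)
    {x : EuclideanSpace ℝ (Fin n)} (hx : x ∈ ρ.growth (-1) r⁻¹) (hx0 : x ≠ 0) :
    ∃ c : ℝ, 0 < c ∧ ∀ t : ℝ, 0 ≤ t → c * α ^ t ≤ ‖ρ.flow t x‖ := by
  have hr0 : 0 < r := by linarith
  have hα1 : 1 < α := hα.1.1
  have hα0 : 0 < α := by linarith
  set z := toComplex n x with hz
  have hz0 : z ≠ 0 := fun h => hx0 (by rw [← rePart_toComplex x, ← hz, h, map_zero])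
  obtain ⟨p, μ, hμ⟩ := exists_aeval_hasEigenvector (ρ.complexFlow 1) hz0
  set w := Polynomial.aeval (ρ.complexFlow 1) p z with hw
  obtain ⟨Cp, hCp0, hCp⟩ := LinearMap.exists_norm_apply_le (Polynomial.aeval (ρ.complexFlow 1) p)
  obtain ⟨Cc, hCc0, hCc⟩ := LinearMap.exists_norm_apply_le (toComplex n)
  have hw0 : 0 < ‖w‖ := norm_pos_iff.2 hμ.2
  have hcomm : ∀ t : ℝ, ρ.complexFlow t w =
      Polynomial.aeval (ρ.complexFlow 1) p (toComplex n (ρ.flow t x)) := by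
    intro t
    rw [← complexFlow_toComplex, hw, ← Module.End.mul_apply, ← Module.End.mul_apply]
    congr 1
    refine Algebra.commute_of_mem_adjoin_singleton_of_commute (R := ℂ) (a := ρ.complexFlow t)
      (b := ρ.complexFlow 1) (Polynomial.aeval_mem_adjoin_singleton _ _) ?_
    rw [Commute, SemiconjBy, ← complexFlow_add, ← complexFlow_add, add_comm]
  have hle : ∀ t : ℝ, ‖ρ.complexFlow t w‖ ≤ Cp * Cc * ‖ρ.flow t x‖ := fun t => by
    rw [hcomm, mul_assoc]
    exact (hCp _).trans (mul_le_mul_of_nonneg_left (hCc _) hCp0.le)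
  have hpow : ∀ k : ℕ, ρ.complexFlow k w = μ ^ k • w := fun k => by
    rw [← hμ.pow_apply, complexFlow_pow, one_mul]
  have hneg : ∀ k : ℕ, w = μ ^ k • ρ.complexFlow (-k) w := fun k => by
    rw [← map_smul, ← hpow, ← Module.End.mul_apply, ← complexFlow_add, neg_add_cancel,
      complexFlow_zero, Module.End.one_apply]
  have hμr : 1 < ‖μ‖ := by
    refine hr.trans_le ?_
    by_contra! hlt
    obtain ⟨C, hC⟩ := hx
    have hb : ∀ k : ℕ, ‖w‖ ≤ Cp * Cc * C * (‖μ‖ / r) ^ k := fun k => by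
      have h1 := hC k k.cast_nonneg
      rw [neg_one_mul, Real.rpow_natCast] at h1
      calc ‖w‖ = ‖μ‖ ^ k * ‖ρ.complexFlow (-k) w‖ := by
            conv_lhs => rw [hneg k]
            rw [norm_smul, norm_pow]
        _ ≤ ‖μ‖ ^ k * (Cp * Cc * (C * r⁻¹ ^ k)) := by
          gcongr
          exact (hle _).trans (by gcongr)
        _ = _ := by rw [div_eq_mul_inv, mul_pow]; ring
    have hlim : Tendsto (fun k : ℕ => Cp * Cc * C * (‖μ‖ / r) ^ k) atTop (𝓝 0) := by
      simpa using (tendsto_pow_atTop_nhds_zero_of_lt_one (by positivity)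
        ((div_lt_one hr0).2 hlt)).const_mul (Cp * Cc * C)
    exact absurd (ge_of_tendsto' hlim hb) (not_le.2 hw0)
  have hαμ : α ≤ ‖μ‖ := hα.2 ⟨hμr, μ, Module.End.hasEigenvalue_of_hasEigenvector hμ, rfl⟩
  obtain ⟨D, hD1, hD⟩ := ρ.exists_norm_flow_le 1
  refine ⟨‖w‖ / (Cp * Cc * D * α), by positivity, fun t ht => ?_⟩
  rw [div_mul_eq_mul_div, div_le_iff₀ (by positivity)]
  set k := ⌊t⌋₊
  have hk1 : (k : ℝ) ≤ t := Nat.floor_le ht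
  have hk2 : t ≤ k + 1 := (Nat.lt_floor_add_one t).le
  have hkt : ‖ρ.flow k x‖ ≤ D * ‖ρ.flow t x‖ := by
    have : ρ.flow k x = ρ.flow (k - t) (ρ.flow t x) := by rw [flow_flow]; congr 2; ring
    rw [this]
    exact hD _ (abs_le.2 ⟨by linarith, by linarith⟩) _
  calc ‖w‖ * α ^ t ≤ ‖w‖ * (‖μ‖ ^ k * α) := by
        gcongr
        calc α ^ t ≤ α ^ ((k : ℝ) + 1) := Real.rpow_le_rpow_of_exponent_le hα1.le hk2
          _ = α ^ k * α := by rw [Real.rpow_add hα0, Real.rpow_natCast, Real.rpow_one]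
          _ ≤ ‖μ‖ ^ k * α := by gcongr
    _ = ‖ρ.complexFlow k w‖ * α := by rw [hpow, norm_smul, norm_pow]; ring
    _ ≤ Cp * Cc * (D * ‖ρ.flow t x‖) * α := by
        gcongr
        exact (hle _).trans (by gcongr)
    _ = _ := by ring

/-- The real or imaginary part of an eigenvector grows exactly like `α ^ t`. -/
lemma IsLeastExpansion.exists_vector (hα : ρ.IsLeastExpansion α) :
    ∃ (v : EuclideanSpace ℝ (Fin n)) (C : ℝ), v ≠ 0 ∧ 0 < C ∧
      ∀ t : ℝ, 0 ≤ t → C⁻¹ * α ^ t ≤ ‖ρ.flow t v‖ ∧ ‖ρ.flow t v‖ ≤ C * α ^ t := by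
  have hα1 : 1 < α := hα.1.1
  have hα0 : 0 < α := by linarith
  obtain ⟨-, μ, hμ, hμα⟩ := hα.1
  obtain ⟨w, hw⟩ := hμ.exists_hasEigenvector
  have hpow : ∀ k : ℕ, ρ.complexFlow k w = μ ^ k • w := fun k => by
    rw [← hw.pow_apply, complexFlow_pow, one_mul]
  have hfut : ∀ k : ℕ, ‖ρ.complexFlow (1 * k) w‖ ≤ ‖w‖ * α ^ k := fun k => by
    rw [one_mul, hpow, norm_smul, norm_pow, hμα, mul_comm]
  have hpast : ∀ k : ℕ, ‖ρ.complexFlow (-1 * k) w‖ ≤ ‖w‖ * α⁻¹ ^ k := fun k => by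
    have h1 : w = μ ^ k • ρ.complexFlow (-1 * k) w := by
      rw [← map_smul, ← hpow, ← Module.End.mul_apply, ← complexFlow_add, neg_one_mul,
        neg_add_cancel, complexFlow_zero, Module.End.one_apply]
    have h2 : ‖w‖ = α ^ k * ‖ρ.complexFlow (-1 * k) w‖ := by
      conv_lhs => rw [h1]
      rw [norm_smul, norm_pow, hμα]
    rw [h2, inv_pow, mul_comm (α ^ k), mul_assoc, mul_inv_cancel₀ (by positivity), mul_one]
  have key : ∀ L : (Fin n → ℂ) →ₗ[ℝ] EuclideanSpace ℝ (Fin n),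
      (∀ t z, L (ρ.complexFlow t z) = ρ.flow t (L z)) → ∀ ε r : ℝ, 0 < r →
      (∀ k : ℕ, ‖ρ.complexFlow (ε * k) w‖ ≤ ‖w‖ * r ^ k) → L w ∈ ρ.growth ε r := by
    intro L hL ε r hr h
    obtain ⟨C, hC0, hC⟩ := LinearMap.exists_norm_apply_le L
    refine mem_growth_of_nat (C := C * ‖w‖) hr fun k => ?_
    rw [← hL, mul_assoc]
    exact (hC _).trans (mul_le_mul_of_nonneg_left (h k) hC0.le)
  have fin : ∀ L : (Fin n → ℂ) →ₗ[ℝ] EuclideanSpace ℝ (Fin n),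
      (∀ t z, L (ρ.complexFlow t z) = ρ.flow t (L z)) → L w ≠ 0 →
      ∃ (v : EuclideanSpace ℝ (Fin n)) (C : ℝ), v ≠ 0 ∧ 0 < C ∧
      ∀ t : ℝ, 0 ≤ t → C⁻¹ * α ^ t ≤ ‖ρ.flow t v‖ ∧ ‖ρ.flow t v‖ ≤ C * α ^ t := by
    intro L hL h0
    obtain ⟨c, hc0, hc⟩ := hα.exists_le_norm_flow hα1
      (key L hL (-1) α⁻¹ (inv_pos.2 hα0) hpast) h0
    obtain ⟨C, hC⟩ := key L hL 1 α hα0 hfut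
    refine ⟨L w, max c⁻¹ C, h0, lt_max_of_lt_left (inv_pos.2 hc0), fun t ht => ⟨?_, ?_⟩⟩
    · refine (mul_le_mul_of_nonneg_right ?_ (by positivity)).trans (hc t ht)
      exact inv_le_of_inv_le₀ hc0 (le_max_left _ _)
    · have := hC t ht
      rw [one_mul] at this
      exact this.trans (mul_le_mul_of_nonneg_right (le_max_right _ _) (by positivity))
  by_cases hre : rePart n w = 0
  · refine fin (imPart n) ρ.imPart_complexFlow fun him => hw.2 ?_
    ext i
    refine Complex.ext ?_ ?_
    · simpa [rePart] using congrArg (fun v => v.ofLp i) hre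
    · simpa [imPart] using congrArg (fun v => v.ofLp i) him
  · exact fin (rePart n) ρ.rePart_complexFlow hre

/-- On the vectors that are contracted in the past and grow at most like `α ^ t` in the future, the
flow is `α ^ t` times a uniformly bi-Lipschitz map. The lower bound follows from the one for single
vectors by compactness of the unit sphere. -/
lemma IsLeastExpansion.exists_bounds (hα : ρ.IsLeastExpansion α) {r : ℝ} (hr : 1 < r) :
    ∃ C : ℝ, 0 < C ∧ ∀ x ∈ ρ.growth (-1) r⁻¹ ⊓ ρ.growth 1 α, ∀ t : ℝ, 0 ≤ t →
      C⁻¹ * α ^ t * ‖x‖ ≤ ‖ρ.flow t x‖ ∧ ‖ρ.flow t x‖ ≤ C * α ^ t * ‖x‖ := by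
  have hα1 : 1 < α := hα.1.1
  have hα0 : 0 < α := by linarith
  obtain ⟨C, hC0, hC'⟩ := ρ.exists_norm_flow_le_of_mem_growth 1 hα0
  have hC : ∀ x ∈ ρ.growth 1 α, ∀ t : ℝ, 0 ≤ t → ‖ρ.flow t x‖ ≤ C * α ^ t * ‖x‖ :=
    fun x hx t ht => by simpa using hC' x hx t ht
  set E := ρ.growth (-1) r⁻¹ ⊓ ρ.growth 1 α
  have hcpt : IsCompact (Metric.sphere (0 : E) 1) := isCompact_sphere _ _
  have hlow : ∃ c : ℝ, 0 < c ∧ ∀ x ∈ Metric.sphere (0 : E) 1, ∀ t : ℝ, 0 ≤ t →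
      c * α ^ t ≤ ‖ρ.flow t x‖ := by
    refine hcpt.induction_on (p := fun s => ∃ c : ℝ, 0 < c ∧ ∀ x ∈ s, ∀ t : ℝ, 0 ≤ t →
      c * α ^ t ≤ ‖ρ.flow t x‖) ⟨1, one_pos, by simp⟩ ?_ ?_ ?_
    · rintro s t hst ⟨c, hc0, hc⟩
      exact ⟨c, hc0, fun x hx => hc x (hst hx)⟩
    · rintro s t ⟨c, hc0, hc⟩ ⟨d, hd0, hd⟩
      refine ⟨min c d, lt_min hc0 hd0, fun x hx τ hτ => ?_⟩
      rcases hx with hx | hx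
      · exact (mul_le_mul_of_nonneg_right (min_le_left _ _) (by positivity)).trans (hc x hx τ hτ)
      · exact (mul_le_mul_of_nonneg_right (min_le_right _ _) (by positivity)).trans (hd x hx τ hτ)
    · intro x hx
      have hx0 : (x : EuclideanSpace ℝ (Fin n)) ≠ 0 := by
        intro h
        have h1 : ‖(x : EuclideanSpace ℝ (Fin n))‖ = 1 := by simpa using hx
        rw [h, norm_zero] at h1
        exact zero_ne_one h1
      obtain ⟨c, hc0, hc⟩ := hα.exists_le_norm_flow hr x.2.1 hx0
      refine ⟨Metric.ball x (c / (2 * C)),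
        mem_nhdsWithin_of_mem_nhds (Metric.ball_mem_nhds _ (by positivity)), c / 2, by positivity,
        fun y hy t ht => ?_⟩
      have h1 := hC _ (x - y).2.2 t ht
      have h2 : ‖x - y‖ ≤ c / (2 * C) := by
        rw [← dist_eq_norm, dist_comm]; exact (Metric.mem_ball.1 hy).le
      have h3 : ‖ρ.flow t (x - y : E)‖ ≤ c / 2 * α ^ t := by
        calc _ ≤ C * α ^ t * (c / (2 * C)) := h1.trans (by gcongr; exact h2)
          _ = _ := by field_simp
      have h4 := hc t ht
      have h5 : ‖ρ.flow t (x : EuclideanSpace ℝ (Fin n))‖ ≤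
          ‖ρ.flow t (x - y : E)‖ + ‖ρ.flow t (y : EuclideanSpace ℝ (Fin n))‖ := by
        rw [Submodule.coe_sub, map_sub]
        exact norm_le_norm_sub_add _ _
      linarith
  obtain ⟨c, hc0, hc⟩ := hlow
  refine ⟨max C c⁻¹, lt_max_of_lt_left hC0, fun x hx t ht => ⟨?_, ?_⟩⟩
  · rcases eq_or_ne x 0 with rfl | hx0
    · simp
    have hn : 0 < ‖x‖ := norm_pos_iff.2 hx0
    have h1 := hc ⟨‖x‖⁻¹ • x, E.smul_mem _ hx⟩ (by
      rw [mem_sphere_zero_iff_norm, Submodule.coe_norm, norm_smul, norm_inv, norm_norm,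
        inv_mul_cancel₀ hn.ne']) t ht
    rw [map_smul, norm_smul, norm_inv, norm_norm, le_inv_mul_iff₀ hn] at h1
    refine le_trans ?_ h1
    rw [mul_comm]
    gcongr
    exact inv_le_of_inv_le₀ hc0 (le_max_right _ _)
  · refine (hC x hx.2 t ht).trans ?_
    gcongr
    exact le_max_left _ _

end OneParameterSubgroup

/-! ### Coarsely linear sequences of times -/

/-- A sequence of times that increases linearly up to bounded errors. -/
def IsCoarselyLinear (Λ : ℝ) (b : ℕ → ℝ) : Prop :=
  ∀ i j : ℕ, i ≤ j → ((j : ℝ) - i) / Λ - Λ ≤ b j - b i ∧ b j - b i ≤ Λ * ((j : ℝ) - i) + Λ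

lemma IsCoarselyLinear.mono {Λ Λ' : ℝ} {b : ℕ → ℝ} (h : IsCoarselyLinear Λ b) (h0 : 0 < Λ)
    (hΛ : Λ ≤ Λ') : IsCoarselyLinear Λ' b := by
  intro i j hij
  have hij' : (0 : ℝ) ≤ (j : ℝ) - i := sub_nonneg.2 (Nat.cast_le.2 hij)
  obtain ⟨h1, h2⟩ := h i j hij
  constructor
  · have : ((j : ℝ) - i) / Λ' ≤ ((j : ℝ) - i) / Λ := by gcongr
    linarith
  · nlinarith

/-- Every time after `b J - b 0` is near one of the differences `b j - b 0` with `J ≤ j`. -/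
lemma IsCoarselyLinear.exists_abs_sub_le {Λ : ℝ} {b : ℕ → ℝ} (h : IsCoarselyLinear Λ b)
    (h1 : 1 ≤ Λ) (J : ℕ) {t : ℝ} (ht : b J - b 0 ≤ t) :
    ∃ j : ℕ, J ≤ j ∧ |t - (b j - b 0)| ≤ 2 * Λ := by
  have h0 : 0 < Λ := by linarith
  have hex : ∃ k : ℕ, t ≤ b (J + k) - b 0 := by
    obtain ⟨k, hk⟩ := exists_nat_ge (Λ * (t - (b J - b 0) + Λ))
    refine ⟨k, ?_⟩
    have h2 := (h J (J + k) (Nat.le_add_right _ _)).1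
    push_cast at h2
    rw [add_sub_cancel_left] at h2
    have : t - (b J - b 0) + Λ ≤ k / Λ := by rw [le_div_iff₀ h0]; linarith
    linarith
  classical
  obtain ⟨k, hk, hmin⟩ := Nat.findX hex
  refine ⟨J + k, Nat.le_add_right _ _, ?_⟩
  rcases k with _ | k
  · rw [add_zero] at hk ⊢
    rw [le_antisymm hk ht, sub_self, abs_zero]
    linarith
  · have h2 := hmin k (Nat.lt_succ_self k)
    have h3 := (h (J + k) (J + (k + 1)) (by omega)).2
    push_cast at h3
    rw [not_le] at h2
    rw [abs_le]
    constructor <;> linarith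

/-! ### Shadowing of pseudo-orbits -/

namespace OneParameterSubgroup

variable {n : ℕ} {ρ : OneParameterSubgroup n} {α : ℝ}

lemma flow_mem_growth {ε r : ℝ} {x : EuclideanSpace ℝ (Fin n)} (s : ℝ) (hx : x ∈ ρ.growth ε r) :
    ρ.flow s x ∈ ρ.growth ε r := by
  obtain ⟨C, hC⟩ := hx
  obtain ⟨D, hD1, hD⟩ := ρ.exists_norm_flow_le |s|
  refine ⟨D * C, fun t ht => ?_⟩
  rw [flow_flow, add_comm, ← flow_flow, mul_assoc]
  exact (hD s le_rfl _).trans (by gcongr; exact hC t ht)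

/-- The splitting `IsLeastExpansion.exists_splitting`, with bounds that also cover a bounded
interval of times of the wrong sign. -/
lemma IsLeastExpansion.exists_splitting_of_neg_le (hα : ρ.IsLeastExpansion α) {r₁ r₂ : ℝ}
    (h₁ : 1 < r₁) (h₂ : 1 < r₂) (h₂α : r₂ < α) (D : ℝ) :
    ∃ (P : EuclideanSpace ℝ (Fin n) →ₗ[ℝ] EuclideanSpace ℝ (Fin n)) (C : ℝ), 0 < C ∧
      (∀ x, P x ∈ ρ.growth (-1) r₂⁻¹) ∧
      (∀ x t, -D ≤ t → ‖ρ.flow t (x - P x)‖ ≤ C * r₁ ^ t * ‖x‖) ∧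
      (∀ x t, -D ≤ t → ‖ρ.flow (-t) (P x)‖ ≤ C * r₂⁻¹ ^ t * ‖x‖) := by
  have hr₁ : 0 < r₁ := by linarith
  have hr₂ : 0 < r₂⁻¹ := inv_pos.2 (by linarith)
  obtain ⟨P, C, hC0, hP, hC₁, hC₂⟩ := hα.exists_splitting h₁ h₂ h₂α
  obtain ⟨B, hB1, hB⟩ := ρ.exists_norm_flow_le |D|
  have hp₁ : 0 < r₁ ^ D := Real.rpow_pos_of_pos hr₁ _
  have hp₂ : 0 < r₂⁻¹ ^ D := Real.rpow_pos_of_pos hr₂ _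
  refine ⟨P, B * C * (r₁ ^ D + r₂⁻¹ ^ D), by positivity, hP, fun x t ht => ?_, fun x t ht => ?_⟩
  · have hp : 0 < r₁ ^ t := Real.rpow_pos_of_pos hr₁ _
    have h : ρ.flow t (x - P x) = ρ.flow (-D) (ρ.flow (t + D) (x - P x)) := by
      rw [flow_flow]; congr 2; ring
    rw [h]
    calc _ ≤ B * (C * r₁ ^ (t + D) * ‖x‖) :=
          (hB _ (abs_neg D).le _).trans (by gcongr; exact hC₁ x _ (by linarith))
      _ = B * C * r₁ ^ D * r₁ ^ t * ‖x‖ := by rw [Real.rpow_add hr₁]; ring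
      _ ≤ _ := by gcongr; linarith
  · have hp : 0 < r₂⁻¹ ^ t := Real.rpow_pos_of_pos hr₂ _
    have h : ρ.flow (-t) (P x) = ρ.flow D (ρ.flow (-(t + D)) (P x)) := by
      rw [flow_flow]; congr 2; ring
    rw [h]
    calc _ ≤ B * (C * r₂⁻¹ ^ (t + D) * ‖x‖) :=
          (hB _ le_rfl _).trans (by gcongr; exact hC₂ x _ (by linarith))
      _ = B * C * r₂⁻¹ ^ D * r₂⁻¹ ^ t * ‖x‖ := by rw [Real.rpow_add hr₂]; ring
      _ ≤ _ := by gcongr; linarith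

/-- Shadowing: a pseudo-orbit `w` of the flow along the times `b j` follows, up to a slowly growing
error, the orbit of a vector `u` contracted in the past. The vector `u` collects the contracted
parts of the initial value and of all the jumps, transported back to time `b 0`. -/
lemma exists_shadow {P : EuclideanSpace ℝ (Fin n) →ₗ[ℝ] EuclideanSpace ℝ (Fin n)}
    {C Λ r₁ r₂ : ℝ} (hC : 0 < C) (hΛ : 1 ≤ Λ) (h₁ : 1 < r₁) (h₂ : 1 < r₂)
    (hP : ∀ x, P x ∈ ρ.growth (-1) r₂⁻¹)
    (hP₁ : ∀ x t, -Λ ≤ t → ‖ρ.flow t (x - P x)‖ ≤ C * r₁ ^ t * ‖x‖)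
    (hP₂ : ∀ x t, -Λ ≤ t → ‖ρ.flow (-t) (P x)‖ ≤ C * r₂⁻¹ ^ t * ‖x‖) :
    ∃ T : ℝ, 0 ≤ T ∧ ∀ (b : ℕ → ℝ) (w : ℕ → EuclideanSpace ℝ (Fin n)), IsCoarselyLinear Λ b →
      (∀ j, ‖w (j + 1) - ρ.flow (b (j + 1) - b j) (w j)‖ ≤ Λ) →
      ∃ u ∈ ρ.growth (-1) r₂⁻¹, ∀ j : ℕ, ‖w j - ρ.flow (b j - b 0) u‖ ≤
        C * r₁ ^ (Λ * j + Λ) * (‖w 0‖ + Λ * j) + T := by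
  have hΛ0 : 0 < Λ := by linarith
  have hr₁ : 0 < r₁ := by linarith
  have hr₂ : 0 < r₂⁻¹ := inv_pos.2 (by linarith)
  have hr₂1 : r₂⁻¹ < 1 := inv_lt_one_of_one_lt₀ h₂
  set q := r₂⁻¹ ^ (1 / Λ) with hq
  have hq0 : 0 < q := Real.rpow_pos_of_pos hr₂ _
  have hq1 : q < 1 := Real.rpow_lt_one hr₂.le hr₂1 (by positivity)
  set B := C * r₂⁻¹ ^ (-Λ) * Λ with hB
  have hB0 : 0 < B := by
    have := Real.rpow_pos_of_pos hr₂ (-Λ)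
    positivity
  refine ⟨B * (1 - q)⁻¹, mul_nonneg hB0.le (inv_nonneg.2 (by linarith)), fun b w hb hw => ?_⟩
  set e : ℕ → EuclideanSpace ℝ (Fin n) := fun i => w (i + 1) - ρ.flow (b (i + 1) - b i) (w i)
    with he
  have hw_sum : ∀ j, w j = ρ.flow (b j - b 0) (w 0) +
      ∑ i ∈ Finset.range j, ρ.flow (b j - b (i + 1)) (e i) := by
    intro j
    induction j with
    | zero => simp [flow_zero_apply]
    | succ j ih =>
      have h1 : w (j + 1) = ρ.flow (b (j + 1) - b j) (w j) + e j := by simp [he]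
      rw [h1]
      nth_rewrite 1 [ih]
      rw [map_add, map_sum, Finset.sum_range_succ, flow_flow, sub_self, flow_zero_apply,
        sub_add_sub_cancel, add_assoc]
      congr 2
      refine Finset.sum_congr rfl fun i _ => ?_
      rw [flow_flow, sub_add_sub_cancel]
  -- The contracted parts of the jumps after step `j` decay geometrically at time `b j`.
  have hdecay : ∀ j i : ℕ, ‖ρ.flow (b j - b (i + j + 1)) (P (e (i + j)))‖ ≤ B * q ^ i := by
    intro j i
    have h1 := (hb j (i + j + 1) (by omega)).1
    push_cast at h1
    have h2 : ((i : ℝ) + j + 1 - j) / Λ = 1 / Λ * i + 1 / Λ := by ring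
    rw [h2] at h1
    have h3 : 0 < 1 / Λ := by positivity
    have h4 : (0 : ℝ) ≤ 1 / Λ * i := by positivity
    rw [← neg_sub]
    refine (hP₂ (e (i + j)) _ (by linarith)).trans ?_
    have h5 : r₂⁻¹ ^ (b (i + j + 1) - b j) ≤ r₂⁻¹ ^ (-Λ) * q ^ i := by
      rw [hq, ← Real.rpow_natCast, ← Real.rpow_mul hr₂.le, ← Real.rpow_add hr₂]
      exact Real.rpow_le_rpow_of_exponent_ge hr₂ hr₂1.le (by linarith)
    calc _ ≤ C * (r₂⁻¹ ^ (-Λ) * q ^ i) * Λ := by gcongr; exact hw _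
      _ = B * q ^ i := by rw [hB]; ring
  have hgeom : HasSum (fun i : ℕ => B * q ^ i) (B * (1 - q)⁻¹) :=
    (hasSum_geometric_of_lt_one hq0.le hq1).mul_left B
  have hsum : Summable fun i : ℕ => ρ.flow (b 0 - b (i + 1)) (P (e i)) :=
    Summable.of_norm_bounded hgeom.summable fun i => hdecay 0 i
  refine ⟨P (w 0) + ∑' i : ℕ, ρ.flow (b 0 - b (i + 1)) (P (e i)), ?_, fun j => ?_⟩
  · refine Submodule.add_mem _ (hP _) ?_
    have hcl : IsClosed (ρ.growth (-1) r₂⁻¹ : Set (EuclideanSpace ℝ (Fin n))) :=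
      Submodule.closed_of_finiteDimensional _
    exact hcl.mem_of_tendsto hsum.hasSum
      (Eventually.of_forall fun s => Submodule.sum_mem _ fun i _ => flow_mem_growth _ (hP _))
  have hflow : ρ.flow (b j - b 0) (P (w 0) + ∑' i : ℕ, ρ.flow (b 0 - b (i + 1)) (P (e i))) =
      ρ.flow (b j - b 0) (P (w 0)) + (∑ i ∈ Finset.range j, ρ.flow (b j - b (i + 1)) (P (e i)) +
        ∑' i : ℕ, ρ.flow (b j - b (i + j + 1)) (P (e (i + j)))) := by
    have hmap : ∀ i, ρ.flow (b j - b 0) (ρ.flow (b 0 - b (i + 1)) (P (e i))) =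
        ρ.flow (b j - b (i + 1)) (P (e i)) := fun i => by
      rw [flow_flow, sub_add_sub_cancel]
    have hsum' := hsum.map (ρ.flow (b j - b 0)) (ρ.flow (b j - b 0)).continuous
    have hsum'' : Summable fun i => ρ.flow (b j - b (i + 1)) (P (e i)) :=
      hsum'.congr hmap
    rw [map_add, ContinuousLinearMap.map_tsum _ hsum, tsum_congr hmap,
      ← hsum''.sum_add_tsum_nat_add j]
  have hdiff : w j - ρ.flow (b j - b 0)
        (P (w 0) + ∑' i : ℕ, ρ.flow (b 0 - b (i + 1)) (P (e i))) =
      (ρ.flow (b j - b 0) (w 0 - P (w 0)) +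
        ∑ i ∈ Finset.range j, ρ.flow (b j - b (i + 1)) (e i - P (e i))) -
      ∑' i : ℕ, ρ.flow (b j - b (i + j + 1)) (P (e (i + j))) := by
    rw [hflow]
    nth_rewrite 1 [hw_sum j]
    simp only [map_sub, Finset.sum_sub_distrib]
    abel
  rw [hdiff]
  refine (norm_sub_le _ _).trans (add_le_add ?_ (tsum_of_norm_bounded hgeom (hdecay j)))
  have hslow : ∀ x i, i ≤ j → ‖ρ.flow (b j - b i) (x - P x)‖ ≤ C * r₁ ^ (Λ * j + Λ) * ‖x‖ := by
    intro x i hij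
    obtain ⟨h3, h4⟩ := hb i j hij
    have h5 : (0 : ℝ) ≤ ((j : ℝ) - i) / Λ := div_nonneg (sub_nonneg.2 (Nat.cast_le.2 hij)) hΛ0.le
    refine (hP₁ x _ (by linarith)).trans ?_
    gcongr
    · exact h₁.le
    · have : Λ * ((j : ℝ) - i) ≤ Λ * j := by
        gcongr
        linarith [(Nat.cast_nonneg i : (0 : ℝ) ≤ i)]
      linarith
  have hpow : 0 < r₁ ^ (Λ * j + Λ) := Real.rpow_pos_of_pos hr₁ _
  calc _ ≤ C * r₁ ^ (Λ * j + Λ) * ‖w 0‖ + ∑ i ∈ Finset.range j, C * r₁ ^ (Λ * j + Λ) * Λ := by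
        refine (norm_add_le _ _).trans (add_le_add (hslow _ 0 (Nat.zero_le _)) ?_)
        refine (norm_sum_le _ _).trans (Finset.sum_le_sum fun i hi => ?_)
        refine (hslow _ (i + 1) (Finset.mem_range.1 hi)).trans ?_
        gcongr
        exact hw i
    _ = _ := by rw [Finset.sum_const, Finset.card_range, nsmul_eq_mul]; ring

/-- A pseudo-orbit that grows exponentially, like `R γ ^ (a j - a 0)` with `R` large, is
eventually comparable to the orbit of a vector contracted in the past. All the constants are
uniform. -/
lemma IsLeastExpansion.exists_comparable_orbit (hα : ρ.IsLeastExpansion α) {γ Λ r : ℝ}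
    (hγ : 1 < γ) (hΛ : 1 ≤ Λ) (hr : 1 < r) (hrα : r < α) :
    ∃ (R₀ : ℝ) (J : ℕ), 0 < R₀ ∧ ∀ (R : ℝ) (a b : ℕ → ℝ) (w : ℕ → EuclideanSpace ℝ (Fin n)),
      R₀ ≤ R → IsCoarselyLinear Λ a → IsCoarselyLinear Λ b →
      (∀ j, ‖w (j + 1) - ρ.flow (b (j + 1) - b j) (w j)‖ ≤ Λ) →
      (∀ j, R * γ ^ (a j - a 0) ≤ Λ * (‖w j‖ + 1)) →
      (∀ j, ‖w j‖ ≤ Λ * (R * γ ^ (a j - a 0) + 1)) →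
      ∃ u ∈ ρ.growth (-1) r⁻¹, ∀ j, J ≤ j →
        (3 * Λ)⁻¹ * (R * γ ^ (a j - a 0)) ≤ ‖ρ.flow (b j - b 0) u‖ ∧
        ‖ρ.flow (b j - b 0) u‖ ≤ 3 * Λ * (R * γ ^ (a j - a 0)) := by
  have hΛ0 : 0 < Λ := by linarith
  have hγ0 : 0 < γ := by linarith
  -- The rate `θ` is the square root of the guaranteed rate of growth of the pseudo-orbit, and `r₁`
  -- is chosen so that the slow part grows at most like `θ ^ j`.
  set θ := γ ^ (1 / (2 * Λ)) with hθ
  have hθ1 : 1 < θ := Real.one_lt_rpow hγ (by positivity)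
  have hθ0 : 0 < θ := by linarith
  set r₁ := γ ^ (1 / (2 * Λ * Λ)) with hr₁
  have hr₁1 : 1 < r₁ := Real.one_lt_rpow hγ (by positivity)
  obtain ⟨P, C, hC0, hP, hP₁, hP₂⟩ := hα.exists_splitting_of_neg_le hr₁1 hr hrα Λ
  obtain ⟨T, hT0, hT⟩ := exists_shadow hC0 hΛ hr₁1 hr hP hP₁ hP₂
  have hγΛ : 0 < γ ^ Λ := Real.rpow_pos_of_pos hγ0 _
  have hlim : Tendsto (fun j : ℕ => 4 * Λ * C * θ * (3 * Λ) * γ ^ Λ * ((j + 1 : ℝ) * (1 / θ) ^ j))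
      atTop (𝓝 0) := by
    have h1 : Tendsto (fun j : ℕ => (j : ℝ) * (1 / θ) ^ j) atTop (𝓝 0) :=
      tendsto_self_mul_const_pow_of_lt_one (by positivity) ((div_lt_one hθ0).2 hθ1)
    have h2 : Tendsto (fun j : ℕ => (1 / θ) ^ j) atTop (𝓝 0) :=
      tendsto_pow_atTop_nhds_zero_of_lt_one (by positivity) ((div_lt_one hθ0).2 hθ1)
    have h3 := (h1.add h2).const_mul (4 * Λ * C * θ * (3 * Λ) * γ ^ Λ)
    simp only [add_zero, mul_zero] at h3
    exact h3.congr fun j => by ring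
  obtain ⟨J, hJ⟩ := eventually_atTop.1 (hlim.eventually (gt_mem_nhds zero_lt_one))
  refine ⟨max 1 (4 * Λ * (T + 1) * γ ^ Λ), J, by positivity,
    fun R a b w hR ha hb hw hlow hupp => ?_⟩
  have hR1 : 1 ≤ R := (le_max_left _ _).trans hR
  have hR2 : 4 * Λ * (T + 1) * γ ^ Λ ≤ R := (le_max_right _ _).trans hR
  obtain ⟨u, hu, hwu⟩ := hT b w hb hw
  refine ⟨u, hu, fun j hj => ?_⟩
  set g := R * γ ^ (a j - a 0) with hg
  have hg1 : R * γ ^ (-Λ) * θ ^ j * θ ^ j ≤ g := by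
    have h1 := (ha 0 j (Nat.zero_le j)).1
    have h2 : γ ^ (-Λ) * θ ^ j * θ ^ j = γ ^ (((j : ℝ) - (0 : ℕ)) / Λ - Λ) := by
      rw [hθ, ← Real.rpow_natCast, ← Real.rpow_mul hγ0.le, ← Real.rpow_add hγ0,
        ← Real.rpow_add hγ0]
      congr 1
      field_simp
      push_cast
      ring
    calc R * γ ^ (-Λ) * θ ^ j * θ ^ j = R * (γ ^ (-Λ) * θ ^ j * θ ^ j) := by ring
      _ ≤ g := by
        rw [h2, hg]
        gcongr
        exact hγ.le
  have hθj : 1 ≤ θ ^ j := one_le_pow₀ hθ1.le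
  have hγΛ' : γ ^ (-Λ) * γ ^ Λ = 1 := by rw [← Real.rpow_add hγ0, neg_add_cancel, Real.rpow_zero]
  have hγneg : 0 < γ ^ (-Λ) := Real.rpow_pos_of_pos hγ0 _
  have hTg : 4 * Λ * (T + 1) ≤ g := by
    calc 4 * Λ * (T + 1) = (4 * Λ * (T + 1) * γ ^ Λ) * γ ^ (-Λ) * 1 * 1 := by
          rw [mul_assoc (4 * Λ * (T + 1)), mul_comm (γ ^ Λ), hγΛ']; ring
      _ ≤ R * γ ^ (-Λ) * θ ^ j * θ ^ j := by gcongr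
      _ ≤ g := hg1
  have hslow : 4 * Λ * (C * r₁ ^ (Λ * j + Λ) * (‖w 0‖ + Λ * j)) ≤ g := by
    have h1 : r₁ ^ (Λ * j + Λ) = θ ^ j * θ := by
      rw [hr₁, hθ, ← Real.rpow_natCast, ← Real.rpow_mul hγ0.le, ← Real.rpow_mul hγ0.le,
        ← Real.rpow_add hγ0]
      congr 1
      field_simp
    have h2 : ‖w 0‖ ≤ Λ * (R + 1) := by simpa using hupp 0
    have h3 : ‖w 0‖ + Λ * j ≤ 3 * Λ * (R * (j + 1)) := by
      have h4 : 0 ≤ Λ * ((R - 1) * (1 + j) + (R + 2 * R * j)) := by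
        have : 0 ≤ R - 1 := by linarith
        positivity
      nlinarith
    have h4 : 4 * Λ * C * θ * (3 * Λ) * γ ^ Λ * ((j + 1 : ℝ) * (1 / θ) ^ j) ≤ 1 := (hJ j hj).le
    rw [one_div, inv_pow, ← mul_assoc, mul_inv_le_iff₀ (by positivity), one_mul] at h4
    calc 4 * Λ * (C * r₁ ^ (Λ * j + Λ) * (‖w 0‖ + Λ * j))
        ≤ 4 * Λ * (C * (θ ^ j * θ) * (3 * Λ * (R * (j + 1)))) := by rw [h1]; gcongr
      _ = (4 * Λ * C * θ * (3 * Λ) * γ ^ Λ * (j + 1)) * (R * γ ^ (-Λ) * θ ^ j) := by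
        linear_combination (-(4 * Λ * C * θ * (3 * Λ) * (j + 1) * R * θ ^ j)) * hγΛ'
      _ ≤ θ ^ j * (R * γ ^ (-Λ) * θ ^ j) := by gcongr
      _ = R * γ ^ (-Λ) * θ ^ j * θ ^ j := by ring
      _ ≤ g := hg1
  have hd := hwu j
  set S := C * r₁ ^ (Λ * j + Λ) * (‖w 0‖ + Λ * j)
  have hup := hupp j
  have hlo := hlow j
  rw [← hg] at hup hlo
  have h5 := norm_sub_norm_le (w j) (ρ.flow (b j - b 0) u)
  have h6 := norm_sub_norm_le (ρ.flow (b j - b 0) u) (w j)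
  rw [norm_sub_rev] at h6
  constructor
  · rw [inv_mul_le_iff₀ (by positivity)]
    nlinarith
  · have hS0 : 0 ≤ S := by
      have := Real.rpow_pos_of_pos (zero_lt_one.trans hr₁1) (Λ * j + Λ)
      positivity
    have h7 : 4 * S ≤ g := by nlinarith
    have h8 : 4 * (T + 1) ≤ g := by nlinarith
    have h9 : Λ * 1 ≤ Λ * g := by gcongr; linarith
    have h10 : 1 * g ≤ Λ * g := by gcongr
    nlinarith

end OneParameterSubgroup

namespace OneParameterSubgroup

variable {n : ℕ} {ρ : OneParameterSubgroup n} {α : ℝ}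

/-- A vector growing exactly like `α ^ t`, with bounds that also cover a bounded interval of
negative times. -/
lemma IsLeastExpansion.exists_vector_of_neg_le (hα : ρ.IsLeastExpansion α) (D : ℝ) :
    ∃ (v : EuclideanSpace ℝ (Fin n)) (C : ℝ), 1 ≤ C ∧
      ∀ t : ℝ, -D ≤ t → α ^ t ≤ C * ‖ρ.flow t v‖ ∧ ‖ρ.flow t v‖ ≤ C * α ^ t := by
  have hα0 : 0 < α := zero_lt_one.trans hα.1.1
  obtain ⟨v, C, hv0, hC0, hC⟩ := hα.exists_vector
  obtain ⟨B, hB1, hB⟩ := ρ.exists_norm_flow_le |D|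
  have hp : 0 < α ^ D := Real.rpow_pos_of_pos hα0 _
  have hp' : 0 < α ^ (-D) := Real.rpow_pos_of_pos hα0 _
  have hpp : α ^ (-D) * α ^ D = 1 := by rw [← Real.rpow_add hα0, neg_add_cancel, Real.rpow_zero]
  refine ⟨v, max 1 (max (B * C * α ^ D) (B * C * α ^ (-D))), le_max_left _ _, fun t ht => ⟨?_, ?_⟩⟩
  · have h1 := (hC (t + D) (by linarith)).1
    have h2 : ρ.flow (t + D) v = ρ.flow D (ρ.flow t v) := by rw [flow_flow, add_comm]
    rw [inv_mul_le_iff₀ hC0, h2] at h1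
    have h3 := hB D le_rfl (ρ.flow t v)
    have h4 : α ^ t = α ^ (-D) * α ^ (t + D) := by
      rw [← Real.rpow_add hα0]; congr 1; ring
    calc α ^ t ≤ α ^ (-D) * (C * (B * ‖ρ.flow t v‖)) := by
          rw [h4]; gcongr; exact h1.trans (by gcongr)
      _ = B * C * α ^ (-D) * ‖ρ.flow t v‖ := by ring
      _ ≤ _ := by gcongr; exact (le_max_right _ _).trans (le_max_right _ _)
  · have h1 := (hC (t + D) (by linarith)).2
    have h2 : ρ.flow t v = ρ.flow (-D) (ρ.flow (t + D) v) := by rw [flow_flow]; congr 2; ring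
    have ht0 : 0 < α ^ t := Real.rpow_pos_of_pos hα0 _
    calc ‖ρ.flow t v‖ ≤ B * (C * α ^ (t + D)) := by
          rw [h2]; exact (hB _ (abs_neg D).le _).trans (by gcongr)
      _ = B * C * α ^ D * α ^ t := by rw [Real.rpow_add hα0]; ring
      _ ≤ _ := by gcongr; exact (le_max_left _ _).trans (le_max_right _ _)

end OneParameterSubgroup

/-! ### Relations that respect horizontal leaves -/

section Relation

open OneParameterSubgroup SolvableGroup

variable {n : ℕ} {ρ σ : OneParameterSubgroup n}

/-- A relation between two metric spaces along which distances grow at most coarsely linearly. -/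
def IsCoarseLipschitzRel {X Y : Type*} [MetricSpace X] [MetricSpace Y] (Λ : ℝ)
    (T : X → Y → Prop) : Prop :=
  ∀ p q p' q', T p q → T p' q' → dist q q' ≤ Λ * (dist p p' + 1)

/-- Each point of `s` is related to some point of `t`. -/
def IsTotalRel {X Y : Type*} (T : X → Y → Prop) (s : Set X) (t : Set Y) : Prop :=
  ∀ p ∈ s, ∃ q ∈ t, T p q

/-- A coarsely Lipschitz relation that takes a horizontal leaf to a horizontal leaf is coarsely
Lipschitz for the intrinsic Euclidean distances of the leaves, because leaves are geodesic and
uniformly properly embedded. -/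
lemma exists_norm_flow_space_sub_le_of_rel (ρ σ : OneParameterSubgroup n) {Λ : ℝ} (hΛ : 1 ≤ Λ) :
    ∃ Λ' : ℝ, 1 ≤ Λ' ∧ ∀ (T : SolvableGroup ρ → SolvableGroup σ → Prop) (t s : ℝ),
      IsCoarseLipschitzRel Λ T → IsTotalRel T (horizontalLeaf ρ t) (horizontalLeaf σ s) →
      ∀ x x' q q', T (mk x t) q → T (mk x' t) q' → q.time = s → q'.time = s →
        ‖σ.flow (-s) (q.space - q'.space)‖ ≤ Λ' * (‖ρ.flow (-t) (x - x')‖ + 1) := by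
  obtain ⟨Ψ, hΨ0, hΨ⟩ := exists_norm_flow_space_sub_le σ (2 * Λ)
  refine ⟨2 * Ψ + 1, by linarith, fun T t s hT hts => ?_⟩
  have hunit : ∀ x x' q q', T (mk x t) q → T (mk x' t) q' → q.time = s →
      ‖ρ.flow (-t) (x - x')‖ ≤ 1 → ‖σ.flow (-s) (q.space - q'.space)‖ ≤ Ψ := by
    intro x x' q q' hq hq' hqs h
    rw [← hqs]
    refine hΨ q q' ((hT _ _ _ _ hq hq').trans ?_)
    have := dist_mk_mk_space_le (ρ := ρ) x x' t
    nlinarith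
  -- A horizontal segment of length at most `k + 1` is cut into `k + 1` pieces of length at most
  -- `1`.
  have hind : ∀ k : ℕ, ∀ x x' q q', T (mk x t) q → T (mk x' t) q' → q.time = s → q'.time = s →
      ‖ρ.flow (-t) (x - x')‖ ≤ k + 1 → ‖σ.flow (-s) (q.space - q'.space)‖ ≤ (k + 1) * Ψ := by
    intro k
    induction k with
    | zero =>
      intro x x' q q' hq hq' hqs hqs' h
      simpa using hunit x x' q q' hq hq' hqs (by simpa using h)
    | succ k ih =>
      intro x x' q q' hq hq' hqs hqs' h
      push_cast at h ⊢
      set y := x - ((k + 1 : ℝ) / (k + 1 + 1)) • (x - x') with hy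
      obtain ⟨q'', hqs'', hq''⟩ := hts (mk y t) rfl
      have h1 : x - y = ((k + 1 : ℝ) / (k + 1 + 1)) • (x - x') := by rw [hy]; abel
      have h2 : y - x' = ((1 : ℝ) / (k + 1 + 1)) • (x - x') := by
        have : (1 : ℝ) / (k + 1 + 1) = 1 - (k + 1 : ℝ) / (k + 1 + 1) := by field_simp; ring
        rw [hy, this, sub_smul, one_smul]; abel
      have h3 := ih x y q q'' hq hq'' hqs hqs'' (by
        rw [h1, map_smul, norm_smul, Real.norm_of_nonneg (by positivity), div_mul_eq_mul_div,
          div_le_iff₀ (by positivity)]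
        gcongr)
      have h4 := hunit y x' q'' q' hq'' hq' hqs'' (by
        rw [h2, map_smul, norm_smul, Real.norm_of_nonneg (by positivity), div_mul_eq_mul_div,
          div_le_iff₀ (by positivity)]
        linarith)
      rw [← sub_add_sub_cancel q.space q''.space q'.space, map_add]
      refine (norm_add_le _ _).trans ?_
      linarith
  intro x x' q q' hq hq' hqs hqs'
  have h := hind ⌊‖ρ.flow (-t) (x - x')‖⌋₊ x x' q q' hq hq' hqs hqs' (Nat.lt_floor_add_one _).le
  have h1 := Nat.floor_le (norm_nonneg (ρ.flow (-t) (x - x')))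
  refine h.trans ?_
  have h2 := norm_nonneg (ρ.flow (-t) (x - x'))
  nlinarith

lemma IsCoarselyLinear.sub_mem {Λ : ℝ} {b : ℕ → ℝ} (h : IsCoarselyLinear Λ b) (h1 : 1 ≤ Λ)
    (j : ℕ) : -Λ ≤ b j - b 0 ∧ (Λ * Λ ≤ j → 0 ≤ b j - b 0) ∧ b j - b 0 ≤ Λ * j + Λ := by
  have h0 : 0 < Λ := by linarith
  obtain ⟨h2, h3⟩ := h 0 j (Nat.zero_le j)
  rw [Nat.cast_zero, sub_zero] at h2 h3
  have h4 : (0 : ℝ) ≤ j / Λ := by positivity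
  refine ⟨by linarith, fun hj => ?_, h3⟩
  have h5 : Λ ≤ j / Λ := by rwa [le_div_iff₀ h0]
  linarith

/-- Two vertical lines of `G_M` whose difference `x` satisfies `‖M^t x‖ ≍ α ^ t` are taken, by a
coarse isomorphism of horizontal leaves, to a pair of pseudo-orbits in `G_N`. Their difference is
shadowed by an orbit of the flow of `N` with the same growth. -/
lemma OneParameterSubgroup.IsLeastExpansion.exists_orbit_of_rel {α β Λ r : ℝ}
    (hα : ρ.IsLeastExpansion α)
    (hβ : σ.IsLeastExpansion β) (hΛ : 1 ≤ Λ) (hr : 1 < r) (hrβ : r < β) :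
    ∃ (c : ℝ) (J : ℕ), 1 ≤ c ∧ Λ * Λ ≤ J ∧ ∀ (a b : ℕ → ℝ)
      (T : SolvableGroup ρ → SolvableGroup σ → Prop),
      IsCoarselyLinear Λ a → IsCoarselyLinear Λ b →
      IsCoarseLipschitzRel Λ T → IsCoarseLipschitzRel Λ (flip T) →
      (∀ j, IsTotalRel T (horizontalLeaf ρ (-a j)) (horizontalLeaf σ (-b j))) →
      (∀ j, IsTotalRel (flip T) (horizontalLeaf σ (-b j)) (horizontalLeaf ρ (-a j))) →
      ∃ u ∈ σ.growth (-1) r⁻¹, ∀ j, J ≤ j →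
        α ^ (a j - a 0) ≤ c * ‖σ.flow (b j - b 0) u‖ ∧
        ‖σ.flow (b j - b 0) u‖ ≤ c * α ^ (a j - a 0) := by
  have hα0 : 0 < α := zero_lt_one.trans hα.1.1
  have hΛ0 : 0 < Λ := by linarith
  obtain ⟨v, C, hC1, hv⟩ := hα.exists_vector_of_neg_le Λ
  have hC0 : 0 < C := by linarith
  obtain ⟨Λ₁, hΛ₁, h₁⟩ := exists_norm_flow_space_sub_le_of_rel ρ σ hΛ
  obtain ⟨Λ₂, hΛ₂, h₂⟩ := exists_norm_flow_space_sub_le_of_rel σ ρ hΛ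
  obtain ⟨Ψ, hΨ0, hΨ⟩ := exists_norm_flow_space_sub_le σ (Λ * (2 * Λ + 1))
  set Λ' := Λ + Λ₁ * C + Λ₂ * C + 2 * Ψ with hΛ'
  have hC₁ : Λ₁ ≤ Λ₁ * C := le_mul_of_one_le_right (by linarith) hC1
  have hC₂ : Λ₂ ≤ Λ₂ * C := le_mul_of_one_le_right (by linarith) hC1
  obtain ⟨R, J, hR0, hRJ⟩ := hβ.exists_comparable_orbit hα.1.1 (Λ := Λ') (by linarith) hr hrβ
  have hΛ'0 : 0 < Λ' := by linarith
  obtain ⟨J', hJ'⟩ := exists_nat_ge (Λ * Λ)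
  refine ⟨max 1 (max (3 * Λ' * R⁻¹) (3 * Λ' * R)), max J J', le_max_left _ _,
    hJ'.trans (Nat.cast_le.2 (le_max_right _ _)), fun a b T ha hb hT hT' htot htot' => ?_⟩
  set x := R • ρ.flow (-a 0) v with hx
  have hxa : ∀ j, ρ.flow (- -a j) (x - 0) = R • ρ.flow (a j - a 0) v := fun j => by
    rw [hx, sub_zero, map_smul, flow_flow, neg_neg, ← sub_eq_add_neg]
  choose q hq hTq using fun j => htot j (mk x (-a j)) rfl
  choose q' hq' hTq' using fun j => htot j (mk 0 (-a j)) rfl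
  have hnorm : ∀ j, ‖ρ.flow (- -a j) (x - 0)‖ = R * ‖ρ.flow (a j - a 0) v‖ := fun j => by
    rw [hxa, norm_smul, Real.norm_of_nonneg hR0.le]
  have hstep : ∀ (y : EuclideanSpace ℝ (Fin n)) (g : ℕ → SolvableGroup σ),
      (∀ j, (g j).time = -b j) → (∀ j, T (mk y (-a j)) (g j)) → ∀ j,
      ‖σ.flow (b (j + 1)) ((g (j + 1)).space - (g j).space)‖ ≤ Ψ := by
    intro y g hg hTg j
    have h3 := hΨ (g (j + 1)) (g j) ((hT _ _ _ _ (hTg (j + 1)) (hTg j)).trans ?_)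
    · rwa [hg, neg_neg] at h3
    · have h4 := dist_mk_mk_time_le (ρ := ρ) y (-a (j + 1)) (-a j)
      obtain ⟨h5, h6⟩ := ha j (j + 1) (Nat.le_succ j)
      push_cast at h5 h6
      rw [add_sub_cancel_left] at h5 h6
      have h7 : |-a (j + 1) - -a j| ≤ 2 * Λ := by
        have : 0 < 1 / Λ := by positivity
        rw [abs_le]; constructor <;> linarith
      gcongr
      linarith
  obtain ⟨u, hu, hub⟩ := hRJ R a b (fun j => σ.flow (b j) ((q j).space - (q' j).space)) le_rfl
    (ha.mono hΛ0 (by linarith)) (hb.mono hΛ0 (by linarith)) (fun j => by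
      have h3 := hstep x q hq hTq j
      have h4 := hstep 0 q' hq' hTq' j
      rw [flow_flow, sub_add_cancel, ← map_sub]
      have : (q (j + 1)).space - (q' (j + 1)).space - ((q j).space - (q' j).space) =
        ((q (j + 1)).space - (q j).space) - ((q' (j + 1)).space - (q' j).space) := by abel
      rw [this, map_sub]
      refine (norm_sub_le _ _).trans ?_
      linarith) (fun j => by
      have h3 := h₂ (flip T) (-b j) (-a j) hT' (htot' j) (q j).space (q' j).space (mk x (-a j))
        (mk 0 (-a j)) (by rw [← hq j]; exact hTq j) (by rw [← hq' j]; exact hTq' j) rfl rfl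
      have h4 : ‖ρ.flow (- -a j) (x - 0)‖ ≤ _ := h3
      rw [hnorm, neg_neg] at h4
      have h5 := (hv (a j - a 0) (ha.sub_mem hΛ j).1).1
      calc R * α ^ (a j - a 0) ≤ C * (R * ‖ρ.flow (a j - a 0) v‖) := by nlinarith
        _ ≤ C * (Λ₂ * (‖σ.flow (b j) ((q j).space - (q' j).space)‖ + 1)) := by gcongr
        _ = Λ₂ * C * (‖σ.flow (b j) ((q j).space - (q' j).space)‖ + 1) := by ring
        _ ≤ _ := by gcongr; linarith) (fun j => by
      have h3 := h₁ T (-a j) (-b j) hT (htot j) x 0 (q j) (q' j) (hTq j) (hTq' j) (hq j) (hq' j)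
      rw [hnorm, neg_neg] at h3
      have h5 := (hv (a j - a 0) (ha.sub_mem hΛ j).1).2
      have h6 : 0 < α ^ (a j - a 0) := Real.rpow_pos_of_pos hα0 _
      calc _ ≤ Λ₁ * (R * (C * α ^ (a j - a 0)) + C) := h3.trans (by gcongr)
        _ = Λ₁ * C * (R * α ^ (a j - a 0) + 1) := by ring
        _ ≤ _ := by gcongr; linarith)
  refine ⟨u, hu, fun j hj => ?_⟩
  obtain ⟨h3, h4⟩ := hub j ((le_max_left _ _).trans hj)
  have h6 : 0 < α ^ (a j - a 0) := Real.rpow_pos_of_pos hα0 _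
  constructor
  · rw [inv_mul_le_iff₀ (by positivity)] at h3
    calc α ^ (a j - a 0) = R⁻¹ * (R * α ^ (a j - a 0)) := by field_simp
      _ ≤ R⁻¹ * (3 * Λ' * ‖σ.flow (b j - b 0) u‖) := by gcongr
      _ = 3 * Λ' * R⁻¹ * ‖σ.flow (b j - b 0) u‖ := by ring
      _ ≤ _ := by gcongr; exact (le_max_left _ _).trans (le_max_right _ _)
  · calc _ ≤ 3 * Λ' * R * α ^ (a j - a 0) := h4.trans_eq (by ring)
      _ ≤ _ := by gcongr; exact (le_max_right _ _).trans (le_max_right _ _)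

/-- A one-sided comparison of times, with a constant that depends on the relation: the orbit
shadowed in `G_N` expands at least like `β ^ t`. -/
lemma OneParameterSubgroup.IsLeastExpansion.exists_time_le_of_rel {α β Λ : ℝ}
    (hα : ρ.IsLeastExpansion α)
    (hβ : σ.IsLeastExpansion β) (hΛ : 1 ≤ Λ) {a b : ℕ → ℝ}
    {T : SolvableGroup ρ → SolvableGroup σ → Prop}
    (ha : IsCoarselyLinear Λ a) (hb : IsCoarselyLinear Λ b)
    (hT : IsCoarseLipschitzRel Λ T) (hT' : IsCoarseLipschitzRel Λ (flip T))
    (htot : ∀ j, IsTotalRel T (horizontalLeaf ρ (-a j)) (horizontalLeaf σ (-b j)))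
    (htot' : ∀ j, IsTotalRel (flip T) (horizontalLeaf σ (-b j)) (horizontalLeaf ρ (-a j))) :
    ∃ (D : ℝ) (J : ℕ), ∀ j, J ≤ j →
      (b j - b 0) * Real.log β ≤ (a j - a 0) * Real.log α + D := by
  have hα0 : 0 < α := zero_lt_one.trans hα.1.1
  have hβ0 : 0 < β := zero_lt_one.trans hβ.1.1
  obtain ⟨r, hr, hrβ⟩ := exists_between hβ.1.1
  obtain ⟨c, J, hc1, hJΛ, h⟩ := hα.exists_orbit_of_rel hβ hΛ hr hrβ
  obtain ⟨u, hu, huJ⟩ := h a b T ha hb hT hT' htot htot'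
  have hc0 : 0 < c := by linarith
  have hu0 : u ≠ 0 := by
    rintro rfl
    have h1 := (huJ J le_rfl).1
    rw [map_zero, norm_zero, mul_zero] at h1
    exact absurd h1 (not_le.2 (Real.rpow_pos_of_pos hα0 _))
  obtain ⟨d, hd0, hd⟩ := hβ.exists_le_norm_flow hr hu hu0
  refine ⟨Real.log c - Real.log d, J, fun j hj => ?_⟩
  have hj' : Λ * Λ ≤ j := hJΛ.trans (Nat.cast_le.2 hj)
  have h1 := (hd _ ((hb.sub_mem hΛ j).2.1 hj')).trans (huJ j hj).2
  have hpβ := Real.rpow_pos_of_pos hβ0 (b j - b 0)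
  have hpα := Real.rpow_pos_of_pos hα0 (a j - a 0)
  have h2 := Real.log_le_log (by positivity) h1
  rw [Real.log_mul hd0.ne' hpβ.ne', Real.log_mul hc0.ne' hpα.ne', Real.log_rpow hβ0,
    Real.log_rpow hα0] at h2
  linarith

/-- Times correspond up to a bounded error: the non-uniform comparisons in both directions force the
shadowed orbit to lie in the subspace on which `N^t` is `β ^ t` times a uniformly bi-Lipschitz map,
and there all constants are uniform. -/
lemma OneParameterSubgroup.IsLeastExpansion.exists_abs_time_sub_le_of_rel {α β Λ : ℝ}
    (hα : ρ.IsLeastExpansion α)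
    (hβ : σ.IsLeastExpansion β) (hΛ : 1 ≤ Λ) :
    ∃ D : ℝ, ∀ (a b : ℕ → ℝ) (T : SolvableGroup ρ → SolvableGroup σ → Prop),
      IsCoarselyLinear Λ a → IsCoarselyLinear Λ b →
      IsCoarseLipschitzRel Λ T → IsCoarseLipschitzRel Λ (flip T) →
      (∀ j, IsTotalRel T (horizontalLeaf ρ (-a j)) (horizontalLeaf σ (-b j))) →
      (∀ j, IsTotalRel (flip T) (horizontalLeaf σ (-b j)) (horizontalLeaf ρ (-a j))) →
      ∀ j, |(b j - b 0) * Real.log β - (a j - a 0) * Real.log α| ≤ D := by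
  have hα0 : 0 < α := zero_lt_one.trans hα.1.1
  have hβ0 : 0 < β := zero_lt_one.trans hβ.1.1
  have hlα : 0 < Real.log α := Real.log_pos hα.1.1
  have hlβ : 0 < Real.log β := Real.log_pos hβ.1.1
  have hΛ0 : 0 < Λ := by linarith
  obtain ⟨r, hr, hrβ⟩ := exists_between hβ.1.1
  obtain ⟨c, J, hc1, hJΛ, h⟩ := hα.exists_orbit_of_rel hβ hΛ hr hrβ
  obtain ⟨C, hC0, hC⟩ := hβ.exists_bounds hr
  have hc0 : 0 < c := by linarith
  set D₀ := (Λ * J + Λ) * (Real.log α + Real.log β) with hD₀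
  refine ⟨2 * (Real.log c + |Real.log C|) + D₀, fun a b T ha hb hT hT' htot htot' => ?_⟩
  have hsmall : ∀ j, j ≤ J → |(b j - b 0) * Real.log β - (a j - a 0) * Real.log α| ≤ D₀ := by
    intro j hj
    obtain ⟨h1, -, h2⟩ := ha.sub_mem hΛ j
    obtain ⟨h3, -, h4⟩ := hb.sub_mem hΛ j
    have h5 : Λ * (j : ℝ) ≤ Λ * J := by gcongr
    have h6 : (0 : ℝ) ≤ Λ * j := by positivity
    have h7 : |a j - a 0| ≤ Λ * J + Λ := abs_le.2 ⟨by linarith, by linarith⟩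
    have h8 : |b j - b 0| ≤ Λ * J + Λ := abs_le.2 ⟨by linarith, by linarith⟩
    refine (abs_sub _ _).trans ?_
    rw [abs_mul, abs_mul, abs_of_pos hlα, abs_of_pos hlβ, hD₀]
    nlinarith
  obtain ⟨u, hu, huJ⟩ := h a b T ha hb hT hT' htot htot'
  have hu0 : u ≠ 0 := by
    rintro rfl
    have h1 := (huJ J le_rfl).1
    rw [map_zero, norm_zero, mul_zero] at h1
    exact absurd h1 (not_le.2 (Real.rpow_pos_of_pos hα0 _))
  obtain ⟨D', J', hD'⟩ := hβ.exists_time_le_of_rel hα hΛ hb ha hT' hT htot' htot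
  have hug : u ∈ σ.growth 1 β := by
    set J₂ := max J J'
    obtain ⟨B, hB1, hB⟩ := σ.exists_norm_flow_le (max (2 * Λ) |b J₂ - b 0|)
    refine ⟨B * (c * Real.exp D' * β ^ (2 * Λ) + ‖u‖), fun t ht => ?_⟩
    rw [one_mul]
    have hpt : 1 ≤ β ^ t := Real.one_le_rpow hβ.1.1.le ht
    have hp2 : 0 < β ^ (2 * Λ) := Real.rpow_pos_of_pos hβ0 _
    rcases le_total (b J₂ - b 0) t with hbt | hbt
    · obtain ⟨j, hj, hjt⟩ := hb.exists_abs_sub_le hΛ J₂ hbt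
      have h1 : ‖σ.flow (b j - b 0) u‖ ≤ c * Real.exp D' * β ^ (2 * Λ) * β ^ t := by
        calc _ ≤ c * α ^ (a j - a 0) := (huJ j ((le_max_left _ _).trans hj)).2
          _ ≤ c * (Real.exp D' * β ^ (b j - b 0)) := by
            gcongr
            rw [Real.rpow_def_of_pos hα0, Real.rpow_def_of_pos hβ0, ← Real.exp_add]
            refine Real.exp_le_exp.2 ?_
            have := hD' j ((le_max_right _ _).trans hj)
            linarith
          _ ≤ c * (Real.exp D' * β ^ (2 * Λ + t)) := by
            gcongr
            · exact hβ.1.1.le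
            · linarith [(abs_le.1 hjt).1]
          _ = _ := by rw [Real.rpow_add hβ0]; ring
      have h2 : σ.flow t u = σ.flow (t - (b j - b 0)) (σ.flow (b j - b 0) u) := by
        rw [flow_flow, sub_add_cancel]
      rw [h2]
      calc _ ≤ B * (c * Real.exp D' * β ^ (2 * Λ) * β ^ t) :=
            (hB _ (hjt.trans (le_max_left _ _)) _).trans (by gcongr)
        _ ≤ B * (c * Real.exp D' * β ^ (2 * Λ) * β ^ t) + B * ‖u‖ * β ^ t :=
            le_add_of_nonneg_right (by positivity)
        _ = _ := by ring
    · calc _ ≤ B * ‖u‖ * 1 := by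
            rw [mul_one]
            refine hB _ ?_ _
            rw [abs_of_nonneg ht]
            exact (hbt.trans (le_abs_self _)).trans (le_max_right _ _)
        _ ≤ B * ‖u‖ * β ^ t := by gcongr
        _ ≤ B * (c * Real.exp D' * β ^ (2 * Λ)) * β ^ t + B * ‖u‖ * β ^ t :=
            le_add_of_nonneg_left (by positivity)
        _ = _ := by ring
  have hn : 0 < ‖u‖ := norm_pos_iff.2 hu0
  have hlarge : ∀ j, J ≤ j →
      |(b j - b 0) * Real.log β - (a j - a 0) * Real.log α + Real.log ‖u‖| ≤
        Real.log c + |Real.log C| := by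
    intro j hj
    have hj' : Λ * Λ ≤ j := hJΛ.trans (Nat.cast_le.2 hj)
    obtain ⟨h1, h2⟩ := hC u ⟨hu, hug⟩ _ ((hb.sub_mem hΛ j).2.1 hj')
    obtain ⟨h3, h4⟩ := huJ j hj
    have hpβ := Real.rpow_pos_of_pos hβ0 (b j - b 0)
    have hpα := Real.rpow_pos_of_pos hα0 (a j - a 0)
    have h5 : C⁻¹ * β ^ (b j - b 0) * ‖u‖ ≤ c * α ^ (a j - a 0) := h1.trans h4
    have h6 : α ^ (a j - a 0) ≤ c * (C * β ^ (b j - b 0) * ‖u‖) := h3.trans (by gcongr)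
    have h7 := Real.log_le_log (by positivity) h5
    have h8 := Real.log_le_log (by positivity) h6
    rw [Real.log_mul (by positivity) hn.ne', Real.log_mul (by positivity) hpβ.ne',
      Real.log_mul hc0.ne' hpα.ne', Real.log_inv, Real.log_rpow hα0, Real.log_rpow hβ0] at h7
    rw [Real.log_mul hc0.ne' (by positivity), Real.log_mul (by positivity) hn.ne',
      Real.log_mul hC0.ne' hpβ.ne', Real.log_rpow hα0, Real.log_rpow hβ0] at h8
    have h9 := le_abs_self (Real.log C)
    have h10 := neg_abs_le (Real.log C)
    rw [abs_le]
    constructor <;> linarith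
  have hlc : 0 ≤ Real.log c := Real.log_nonneg hc1
  intro j
  rcases le_total j J with hj | hj
  · have := hsmall j hj
    have h9 := abs_nonneg (Real.log C)
    linarith
  · have h1 := abs_le.1 (hlarge j hj)
    have h2 := abs_le.1 (hlarge J le_rfl)
    have h3 := abs_le.1 (hsmall J le_rfl)
    rw [abs_le]
    constructor <;> linarith [h1.1, h1.2, h2.1, h2.2, h3.1, h3.2]

end Relation

/-! ### Eigenvalues of absolute Jordan forms -/

section Jordan

variable {K : Type*} [Field K]

lemma isRoot_charpoly_jordanBlock_iff {k : ℕ} (hk : 0 < k) (a x : K) :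
    (jordanBlock k a).charpoly.IsRoot x ↔ x = a := by
  have hup : (jordanBlock k a).IsUpperTriangular := by
    intro i j hij
    have h1 : (j : ℕ) < i := hij
    have h2 : ¬ i = j := fun h => by rw [h] at h1; exact lt_irrefl _ h1
    have h3 : ¬ (i : ℕ) + 1 = j := by omega
    simp [jordanBlock, h2, h3]
  have hdiag : ∀ i, jordanBlock k a i i = a := fun i => by simp [jordanBlock]
  rw [Matrix.charpoly_of_isUpperTriangular _ hup]
  simp only [hdiag, Finset.prod_const, Finset.card_univ, Fintype.card_fin]
  rw [Polynomial.IsRoot, Polynomial.eval_pow, pow_eq_zero_iff hk.ne']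
  simp [sub_eq_zero]

/-- The eigenvalues of a matrix in Jordan form are its diagonal entries. -/
lemma isRoot_charpoly_jordanMatrix_iff {n r : ℕ} {k : Fin r → ℕ} (hk : ∑ i, k i = n)
    {a : Fin r → K} (hpos : ∀ i, 0 < k i) (x : K) :
    (jordanMatrix k hk a).charpoly.IsRoot x ↔ ∃ i, x = a i := by
  have hblock : ∀ i, ((Matrix.blockDiagonal' fun i => jordanBlock (k i) (a i)).toSquareBlock
      Sigma.fst i).charpoly = (jordanBlock (k i) (a i)).charpoly := by
    intro i
    let e : Fin (k i) ≃ {p : Σ i, Fin (k i) // p.1 = i} :=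
      { toFun := fun j => ⟨⟨i, j⟩, rfl⟩
        invFun := fun p => cast (by rw [p.2]) p.1.2
        left_inv := fun j => rfl
        right_inv := by rintro ⟨⟨i', j⟩, rfl⟩; rfl }
    rw [← Matrix.charpoly_reindex e]
    congr 1
    ext p q
    obtain ⟨p, rfl⟩ := e.surjective p
    obtain ⟨q, rfl⟩ := e.surjective q
    rw [Matrix.reindex_apply, Matrix.submatrix_apply, e.symm_apply_apply, e.symm_apply_apply]
    exact Matrix.blockDiagonal'_apply_eq (fun i => jordanBlock (k i) (a i)) i p q
  rw [jordanMatrix, Matrix.charpoly_reindex,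
    (Matrix.blockTriangular_blockDiagonal' fun i => jordanBlock (k i) (a i)).charpoly,
    Polynomial.IsRoot, Polynomial.eval_prod, Finset.prod_eq_zero_iff]
  constructor
  · rintro ⟨i, -, hi⟩
    rw [hblock] at hi
    exact ⟨i, (isRoot_charpoly_jordanBlock_iff (hpos i) _ _).1 hi⟩
  · rintro ⟨i, hi⟩
    refine ⟨i, Finset.mem_image.2 ⟨⟨i, ⟨0, hpos i⟩⟩, Finset.mem_univ _, rfl⟩, ?_⟩
    rw [hblock]
    exact (isRoot_charpoly_jordanBlock_iff (hpos i) _ _).2 hi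

lemma hasEigenvalue_toLin'_iff_isRoot {n : ℕ} (A : Matrix (Fin n) (Fin n) K) (x : K) :
    Module.End.HasEigenvalue (Matrix.toLin' A) x ↔ A.charpoly.IsRoot x := by
  rw [Module.End.hasEigenvalue_iff_isRoot_charpoly, Matrix.charpoly_toLin']

/-- The eigenvalues of the absolute Jordan form are the moduli of the complex eigenvalues; here those
greater than `1`. -/
lemma IsAbsoluteJordanForm.eigenvaluesGtOne_eq {n : ℕ} {M J : Matrix (Fin n) (Fin n) ℝ}
    (h : IsAbsoluteJordanForm M J) : eigenvaluesGtOne J = {r : ℝ | 1 < r ∧ ∃ μ : ℂ,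
      Module.End.HasEigenvalue (Matrix.toLin' (M.map Complex.ofReal)) μ ∧ ‖μ‖ = r} := by
  obtain ⟨r, k, hk, a, hpos, ⟨P, hP⟩, -, rfl⟩ := h
  ext x
  refine and_congr_right fun _ => ?_
  simp only [hasEigenvalue_toLin'_iff_isRoot]
  rw [isRoot_charpoly_jordanMatrix_iff hk hpos, hP, Matrix.coe_units_inv,
    Matrix.charpoly_units_conj]
  simp only [isRoot_charpoly_jordanMatrix_iff hk hpos]
  constructor
  · rintro ⟨i, hi⟩
    exact ⟨a i, ⟨i, rfl⟩, hi.symm⟩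
  · rintro ⟨μ, ⟨i, rfl⟩, hi⟩
    exact ⟨i, hi.symm⟩

end Jordan

/-! ### Induced time changes -/

section TimeChange

/-- A coarsely bi-Lipschitz function at bounded distance from a coarsely increasing one increases
coarsely linearly. The constants do not involve the coarsely increasing function, which only
determines the sign of the increments at infinity. -/
lemma exists_le_sub_of_isCoarselyIncreasing {K C : ℝ} (hK : 1 ≤ K) (hC : 0 ≤ C) :
    ∃ C' : ℝ, 0 ≤ C' ∧ ∀ h h₁ : ℝ → ℝ, ∀ E : ℝ, (∀ t s, |h t - h s| ≤ K * |t - s| + C) →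
      (∀ t s, |t - s| / K - C ≤ |h t - h s|) → IsCoarselyIncreasing h₁ → (∀ t, |h t - h₁ t| ≤ E) →
      ∀ s t, s ≤ t → (t - s) / K - C' ≤ h t - h s := by
  have hK0 : 0 < K := by linarith
  set L := K * (K + 2 * C + 1) with hL
  have hL0 : 0 < L := by positivity
  have hLK : L / K = K + 2 * C + 1 := by rw [hL]; field_simp
  refine ⟨K * L + C + L / K, by positivity, fun h h₁ E hup hlow ⟨M, hM0, hM⟩ hE s t hst => ?_⟩
  rcases le_or_gt L (t - s) with hts | hts
  · -- The increments `h (t + k) - h s` exceed the possible jumps, so they have constant sign.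
    have habs : ∀ k : ℕ, (t + k - s) / K - C ≤ |h (t + k) - h s| := fun k => by
      have h1 := hlow (t + k) s
      rwa [abs_of_nonneg (by have := k.cast_nonneg (α := ℝ); linarith)] at h1
    have hbig : ∀ k : ℕ, K + C + 1 ≤ (t + k - s) / K - C := fun k => by
      have h1 : L / K ≤ (t + k - s) / K := by
        gcongr
        have := k.cast_nonneg (α := ℝ)
        linarith
      linarith
    have hpos : 0 < h t - h s := by
      by_contra! hneg
      have hind : ∀ k : ℕ, h (t + k) - h s ≤ 0 := by
        intro k
        induction k with
        | zero => simpa using hneg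
        | succ k ih =>
          by_contra! hlt
          have h1 := (hbig k).trans (habs k)
          have h2 := (hbig (k + 1)).trans (habs (k + 1))
          have h3 := hup (t + (k + 1 : ℕ)) (t + k)
          rw [abs_of_nonpos ih] at h1
          rw [abs_of_pos hlt] at h2
          have h4 : t + ((k + 1 : ℕ) : ℝ) - (t + k) = 1 := by push_cast; ring
          rw [h4, abs_one, mul_one] at h3
          have h5 := (le_abs_self _).trans h3
          linarith
      obtain ⟨k, hk⟩ := exists_nat_ge (K * (2 * E + C + 1) + M + 1)
      have hk0 : (0 : ℝ) ≤ k := k.cast_nonneg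
      have hE0 : 0 ≤ E := (abs_nonneg _).trans (hE 0)
      have h1 := hM s (t + k) (by
        have : 0 ≤ K * (2 * E + C + 1) := by positivity
        linarith)
      have h2 := habs k
      rw [abs_of_nonpos (hind k)] at h2
      have h3 : 2 * E + C + 1 ≤ (t + k - s) / K := by
        rw [le_div_iff₀ hK0]; linarith
      have h4 := abs_le.1 (hE s)
      have h5 := abs_le.1 (hE (t + k))
      linarith [h4.1, h4.2, h5.1, h5.2]
    have h1 := habs 0
    rw [Nat.cast_zero, add_zero, abs_of_pos hpos] at h1
    have : 0 ≤ K * L + L / K := by positivity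
    linarith
  · have h1 := (abs_le.1 (hup t s)).1
    rw [abs_of_nonneg (by linarith)] at h1
    have h2 : (t - s) / K ≤ L / K := by gcongr
    have h3 : K * (t - s) ≤ K * L := by gcongr
    linarith

end TimeChange

section QuasiIsometry

open SolvableGroup OneParameterSubgroup

variable {n : ℕ} {ρ σ : OneParameterSubgroup n} {φ : SolvableGroup ρ → SolvableGroup σ}

lemma IsInducedTimeChange.exists_right {h : ℝ → ℝ} {A : ℝ} (hφ : IsInducedTimeChange φ h A)
    (p : SolvableGroup ρ) :
    ∃ q : SolvableGroup σ, q.time = h p.time ∧ dist (φ p) q ≤ A + 1 := by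
  have h1 : Metric.hausdorffEDist (φ '' horizontalLeaf ρ p.time) (horizontalLeaf σ (h p.time)) <
      ENNReal.ofReal (A + 1) :=
    (hφ.2 p.time).trans_lt ((ENNReal.ofReal_lt_ofReal_iff (by linarith [hφ.1])).2 (lt_add_one A))
  have hp : p ∈ horizontalLeaf ρ p.time := rfl
  obtain ⟨q, hq, hpq⟩ := Metric.exists_edist_lt_of_hausdorffEDist_lt (mem_image_of_mem φ hp) h1
  refine ⟨q, hq, ?_⟩
  rw [edist_dist] at hpq
  exact (ENNReal.ofReal_le_ofReal_iff (by linarith [hφ.1])).1 hpq.le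

lemma IsInducedTimeChange.exists_left {h : ℝ → ℝ} {A : ℝ} (hφ : IsInducedTimeChange φ h A)
    (t : ℝ) {q : SolvableGroup σ} (hq : q.time = h t) :
    ∃ p : SolvableGroup ρ, p.time = t ∧ dist (φ p) q ≤ A + 1 := by
  have h1 : Metric.hausdorffEDist (horizontalLeaf σ (h t)) (φ '' horizontalLeaf ρ t) <
      ENNReal.ofReal (A + 1) := by
    rw [Metric.hausdorffEDist_comm]
    exact (hφ.2 t).trans_lt
      ((ENNReal.ofReal_lt_ofReal_iff (by linarith [hφ.1])).2 (lt_add_one A))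
  have hq' : q ∈ horizontalLeaf σ (h t) := hq
  obtain ⟨_, ⟨p, hp, rfl⟩, hpq⟩ := Metric.exists_edist_lt_of_hausdorffEDist_lt hq' h1
  refine ⟨p, hp, ?_⟩
  rw [edist_comm, edist_dist] at hpq
  exact (ENNReal.ofReal_le_ofReal_iff (by linarith [hφ.1])).1 hpq.le

lemma IsQuasiIsometry.dist_le_of_dist_le {K C A : ℝ} (hK : 1 ≤ K) (hφ : IsQuasiIsometry K C φ)
    {p p' : SolvableGroup ρ} {q q' : SolvableGroup σ} (h : dist (φ p) q ≤ A + 1)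
    (h' : dist (φ p') q' ≤ A + 1) :
    dist q q' ≤ K * dist p p' + (C + 2 * A + 2) ∧
      dist p p' ≤ K * (dist q q' + (C + 2 * A + 2)) := by
  have hK0 : 0 < K := by linarith
  obtain ⟨h1, h2⟩ := hφ.1 p p'
  constructor
  · have h3 := dist_triangle4 q (φ p) (φ p') q'
    rw [dist_comm q (φ p)] at h3
    linarith
  · have h3 := dist_triangle4 (φ p) q q' (φ p')
    rw [dist_comm q' (φ p')] at h3
    have h4 : 1 / K * dist p p' ≤ dist q q' + (C + 2 * A + 2) := by linarith
    rwa [one_div, inv_mul_le_iff₀ hK0] at h4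

/-- An induced time change of a quasi-isometry is a quasi-isometry of the line. -/
lemma IsInducedTimeChange.abs_sub_le {K C A : ℝ} {h : ℝ → ℝ} (hK : 1 ≤ K)
    (hφ : IsQuasiIsometry K C φ) (hh : IsInducedTimeChange φ h A) (t s : ℝ) :
    |h t - h s| ≤ K * |t - s| + (C + 2 * A + 2) ∧
      |t - s| / K - (C + 2 * A + 2) ≤ |h t - h s| := by
  have hK0 : 0 < K := by linarith
  constructor
  · obtain ⟨q, hq, hpq⟩ := hh.exists_right (mk 0 t)
    obtain ⟨q', hq', hpq'⟩ := hh.exists_right (mk 0 s)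
    have h1 := (hφ.dist_le_of_dist_le hK hpq hpq').1
    have h2 := abs_time_sub_le_dist q q'
    have h3 := dist_mk_mk_time_le (ρ := ρ) 0 t s
    rw [hq, hq'] at h2
    exact h2.trans (h1.trans (by gcongr))
  · obtain ⟨p, hp, hpq⟩ := hh.exists_left t (q := mk 0 (h t)) rfl
    obtain ⟨p', hp', hpq'⟩ := hh.exists_left s (q := mk 0 (h s)) rfl
    have h1 := (hφ.dist_le_of_dist_le hK hpq hpq').2
    have h2 := abs_time_sub_le_dist p p'
    have h3 := dist_mk_mk_time_le (ρ := σ) 0 (h t) (h s)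
    rw [hp, hp'] at h2
    rw [sub_le_iff_le_add, div_le_iff₀ hK0, mul_comm]
    exact h2.trans (h1.trans (by gcongr))

/-- Two induced time changes of the same map are at bounded distance. -/
lemma IsInducedTimeChange.abs_sub_le_of_isInducedTimeChange {A A₁ : ℝ} {h h₁ : ℝ → ℝ}
    (hh : IsInducedTimeChange φ h A) (hh₁ : IsInducedTimeChange φ h₁ A₁) (t : ℝ) :
    |h t - h₁ t| ≤ A + 1 + (A₁ + 1) := by
  obtain ⟨q, hq, hpq⟩ := hh.exists_right (mk 0 t)
  obtain ⟨q', hq', hpq'⟩ := hh₁.exists_right (mk 0 t)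
  have h1 := abs_time_sub_le_dist q q'
  have h2 := dist_triangle_left q q' (φ (mk 0 t))
  rw [hq, hq'] at h1
  have h3 : h (time (mk 0 t : SolvableGroup ρ)) = h t := rfl
  have h4 : h₁ (time (mk 0 t : SolvableGroup ρ)) = h₁ t := rfl
  rw [h3, h4] at h1
  linarith

/-- Moving the target leaves by a bounded time preserves induced time changes. -/
lemma IsInducedTimeChange.of_abs_sub_le {A B : ℝ} {h h' : ℝ → ℝ}
    (hh : IsInducedTimeChange φ h A) (hB : 0 ≤ B) (h1 : ∀ t, |h t - h' t| ≤ B) :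
    IsInducedTimeChange φ h' (A + B) := by
  refine ⟨add_nonneg hh.1 hB, fun t => ?_⟩
  rw [ENNReal.ofReal_add hh.1 hB]
  refine Metric.hausdorffEDist_triangle.trans (add_le_add (hh.2 t) ?_)
  have key : ∀ s s' : ℝ, |s - s'| ≤ B → ∀ q ∈ horizontalLeaf σ s, ∃ q' ∈ horizontalLeaf σ s',
      edist q q' ≤ ENNReal.ofReal B := by
    rintro s s' hs q rfl
    refine ⟨mk q.space s', rfl, ?_⟩
    rw [edist_dist]
    exact ENNReal.ofReal_le_ofReal ((dist_mk_mk_time_le q.space q.time s').trans hs)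
  exact Metric.hausdorffEDist_le_of_mem_edist (key _ _ (h1 t))
    (key _ _ (by rw [abs_sub_comm]; exact h1 t))

/-- The increments of an induced time change are those of a linear function of slope
`log α / log β`, up to a uniform error. -/
lemma OneParameterSubgroup.IsLeastExpansion.exists_abs_timeChange_sub_le {α β : ℝ}
    (hα : ρ.IsLeastExpansion α) (hβ : σ.IsLeastExpansion β) {K C A : ℝ} (hK : 1 ≤ K) (hC : 0 ≤ C)
    (hA : 0 ≤ A) :
    ∃ D : ℝ, ∀ (φ : SolvableGroup ρ → SolvableGroup σ) (h : ℝ → ℝ), IsQuasiIsometry K C φ →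
      RespectsOrientedHorizontalFoliations φ → IsInducedTimeChange φ h A →
      ∀ (s : ℝ) (j : ℕ), |h s - h (s - j) - Real.log α / Real.log β * j| ≤ D := by
  have hlβ : 0 < Real.log β := Real.log_pos hβ.1.1
  have hC₁ : 0 ≤ C + 2 * A + 2 := by positivity
  set C₁ := C + 2 * A + 2
  obtain ⟨C₂, hC₂, hmono⟩ := exists_le_sub_of_isCoarselyIncreasing hK hC₁
  have hK0 : 0 < K := by linarith
  set Λ := 1 + K + K * C₁ + C₁ + C₂ with hΛdef
  have hKC : 0 ≤ K * C₁ := by positivity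
  have hΛ : 1 ≤ Λ := by linarith
  have hΛ0 : 0 < Λ := by linarith
  obtain ⟨D, hD⟩ := hα.exists_abs_time_sub_le_of_rel hβ hΛ
  refine ⟨D / Real.log β, fun φ h hφ ⟨h₁, A₁, hh₁, hinc⟩ hh s j => ?_⟩
  have hm := hmono h h₁ _ (fun t s => (hh.abs_sub_le hK hφ t s).1)
    (fun t s => (hh.abs_sub_le hK hφ t s).2) hinc (hh.abs_sub_le_of_isInducedTimeChange hh₁)
  have key := hD (fun j => j - s) (fun j => -h (s - j)) (fun p q => dist (φ p) q ≤ A + 1)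
    (fun i j hij => by
      have hij' : (0 : ℝ) ≤ (j : ℝ) - i := sub_nonneg.2 (Nat.cast_le.2 hij)
      have h1 : ((j : ℝ) - i) / Λ ≤ (j : ℝ) - i := div_le_self hij' hΛ
      constructor
      · linarith
      · nlinarith)
    (fun i j hij => by
      have hij' : (0 : ℝ) ≤ (j : ℝ) - i := sub_nonneg.2 (Nat.cast_le.2 hij)
      have h1 := hm (s - j) (s - i) (by linarith)
      have h2 := (abs_le.1 (hh.abs_sub_le hK hφ (s - i) (s - j)).1).2
      have h3 : s - i - (s - j) = (j : ℝ) - i := by ring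
      rw [h3] at h1 h2
      rw [abs_of_nonneg hij'] at h2
      have h4 : ((j : ℝ) - i) / Λ ≤ ((j : ℝ) - i) / K := by
        gcongr
        linarith
      have h5 : K * ((j : ℝ) - i) ≤ Λ * ((j : ℝ) - i) := by
        gcongr
        linarith
      constructor <;> linarith)
    (fun p q p' q' hpq hpq' => by
      have h1 := (hφ.dist_le_of_dist_le hK hpq hpq').1
      have h2 := dist_nonneg (x := p) (y := p')
      have h3 : K * dist p p' ≤ Λ * dist p p' := by
        gcongr
        linarith
      linarith)
    (fun q p q' p' hpq hpq' => by
      have h1 := (hφ.dist_le_of_dist_le hK hpq hpq').2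
      have h2 := dist_nonneg (x := q) (y := q')
      have h3 : K * dist q q' ≤ Λ * dist q q' := by
        gcongr
        linarith
      linarith)
    (fun j p hp => by
      obtain ⟨q, hq, hpq⟩ := hh.exists_right p
      refine ⟨q, ?_, hpq⟩
      have h1 : p.time = -(j - s) := hp
      change q.time = - -h (s - j)
      rw [hq, h1, neg_neg, neg_sub])
    (fun j q hq => by
      have h1 : q.time = - -h (s - j) := hq
      rw [neg_neg] at h1
      obtain ⟨p, hp, hpq⟩ := hh.exists_left (s - j) h1
      refine ⟨p, ?_, hpq⟩
      change p.time = -(j - s)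
      rw [hp, neg_sub]) j
  rw [le_div_iff₀ hlβ, ← abs_of_pos hlβ, ← abs_mul, abs_of_pos hlβ]
  refine le_of_eq_of_le (congrArg abs ?_) key
  simp only [Nat.cast_zero, sub_zero]
  field_simp
  ring

end QuasiIsometry

end

theorem mainTheorem8 {n : ℕ} (ρM ρN : OneParameterSubgroup n)
    (hM : HasExpandingEigenvalue (ρM.pow 1)) (hN : HasExpandingEigenvalue (ρN.pow 1)) :
    ∃ m : ℝ, 0 < m ∧
      (∀ K C A : ℝ, 1 ≤ K → 0 ≤ C → 0 ≤ A →
        ∃ A' : ℝ, 0 ≤ A' ∧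
          ∀ φ : SolvableGroup ρM → SolvableGroup ρN,
            IsQuasiIsometry K C φ →
            RespectsOrientedHorizontalFoliations φ →
            (∃ h : ℝ → ℝ, IsInducedTimeChange φ h A) →
            ∃ b : ℝ, IsInducedTimeChange φ (fun t => m * t + b) A') ∧
      (∀ JM JN : Matrix (Fin n) (Fin n) ℝ,
        IsAbsoluteJordanForm (ρM.pow 1) JM → IsAbsoluteJordanForm (ρN.pow 1) JN →
        ∃ α β : ℝ, IsLeast (eigenvaluesGtOne JM) α ∧ IsLeast (eigenvaluesGtOne JN) β ∧
          m = Real.log α / Real.log β) := by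
  obtain ⟨α, hα⟩ := OneParameterSubgroup.exists_isLeastExpansion ρM hM
  obtain ⟨β, hβ⟩ := OneParameterSubgroup.exists_isLeastExpansion ρN hN
  have hm : 0 < Real.log α / Real.log β := div_pos (Real.log_pos hα.1.1) (Real.log_pos hβ.1.1)
  refine ⟨Real.log α / Real.log β, hm, fun K C A hK hC hA => ?_, fun JM JN hJM hJN => ?_⟩
  · set m := Real.log α / Real.log β
    obtain ⟨D, hD⟩ := hα.exists_abs_timeChange_sub_le hβ hK hC hA
    refine ⟨A + (|D| + m + K + (C + 2 * A + 2)), by positivity, fun φ hφ hresp ⟨h, hh⟩ => ?_⟩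
    refine ⟨h 0, hh.of_abs_sub_le (by positivity) fun t => ?_⟩
    have hD' := fun s j => (hD φ h hφ hresp hh s j).trans (le_abs_self D)
    -- The claim for a time in `[-1, 1]` is the coarse Lipschitz bound; other times are reduced to
    -- it by integer steps.
    have hsmall : ∀ s, |s| ≤ 1 → |h s - h 0| ≤ K + (C + 2 * A + 2) ∧ |m * s| ≤ m := fun s hs => by
      constructor
      · refine (hh.abs_sub_le hK hφ s 0).1.trans ?_
        rw [sub_zero]
        nlinarith
      · rw [abs_mul, abs_of_pos hm]
        exact mul_le_of_le_one_right hm.le hs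
    rcases le_total 0 t with ht | ht
    · have hj1 := Nat.floor_le ht
      have hj2 := Nat.lt_floor_add_one t
      have h1 := abs_le.1 (hD' t ⌊t⌋₊)
      obtain ⟨h2, h3⟩ := hsmall (t - ⌊t⌋₊) (abs_le.2 ⟨by linarith, by linarith⟩)
      rw [mul_sub] at h3
      rw [abs_le] at h2 h3 ⊢
      constructor <;> linarith [h1.1, h1.2, h2.1, h2.2, h3.1, h3.2]
    · have hj1 := Nat.floor_le (neg_nonneg.2 ht)
      have hj2 := Nat.lt_floor_add_one (-t)
      have h1 := abs_le.1 (hD' (t + ⌊-t⌋₊) ⌊-t⌋₊)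
      rw [add_sub_cancel_right] at h1
      obtain ⟨h2, h3⟩ := hsmall (t + ⌊-t⌋₊) (abs_le.2 ⟨by linarith, by linarith⟩)
      rw [mul_add] at h3
      rw [abs_le] at h2 h3 ⊢
      constructor <;> linarith [h1.1, h1.2, h2.1, h2.2, h3.1, h3.2]
  · refine ⟨α, β, ?_, ?_, rfl⟩
    · rw [hJM.eigenvaluesGtOne_eq]
      exact hα
    · rw [hJN.eigenvaluesGtOne_eq]
      exact hβ
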